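/- Let $n\ge 2$, and let $\mathbb S^{n-1}$ be the unit sphere of $\mathbb R^n$ with surface measure $d\mathbf u$. Let $\mathcal S_0(\mathbb R^n)$ be the space of complex-valued Schwartz functions $\phi$ on $\mathbb R^n$ with $\int_{\mathbb R^n}\mathbf x^{m}\phi(\mathbf x)\,d\mathbf x=0$ for all multi-indices $m\in\mathbb N_0^n$, with the topology induced by $\mathcal S(\mathbb R^n)$. Let $\mathcal S(\mathbb S^{n-1}\times\mathbb R)$ be the space of complex-valued functions $\varrho\in C^\infty(\mathbb S^{n-1}\times\mathbb R)$ such that every derivative of $\varrho(\mathbf u,p)$ (of any order, along the sphere and in $p$, mixed derivatives included), multiplied by any power $(1+|p|)^k$, $k\in\mathbb N_0$, is bounded on $\mathbb S^{n-1}\times\mathbb R$, with the locally convex topology given by the corresponding supremum seminorms. Let $\mathcal S_0(\mathbb S^{n-1}\times\mathbb R)$ be the subspace of those $\varrho\in\mathcal S(\mathbb S^{n-1}\times\mathbb R)$ with $\int_{-\infty}^{\infty}p^k\varrho(\mathbf u,p)\,dp=0$ for all $\mathbf u\in\mathbb S^{n-1}$ and $k\in\mathbb N_0$, with the induced topology.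 For $\phi\in\mathcal S_0(\mathbb R^n)$ and $\varrho\in\mathcal S_0(\mathbb S^{n-1}\times\mathbb R)$ define the Radon transform and the dual Radon transform by $$R\phi(\mathbf u,p)=\int_{\mathbf x\cdot\mathbf u=p}\phi(\mathbf x)\,d\mathbf x,\qquad R^{*}\varrho(\mathbf x)=\int_{\mathbb S^{n-1}}\varrho(\mathbf u,\mathbf x\cdot\mathbf u)\,d\mathbf u,$$ where $\mathbf u\in\mathbb S^{n-1}$, $p\in\mathbb R$, $\mathbf x\in\mathbb R^n$, and the first integral is taken with respect to $(n-1)$-dimensional Lebesgue measure on the hyperplane $\{\mathbf x\in\mathbb R^n:\mathbf x\cdot\mathbf u=p\}$. Then $R$ maps $\mathcal S_0(\mathbb R^n)$ into $\mathcal S_0(\mathbb S^{n-1}\times\mathbb R)$ and $R^{*}$ maps $\mathcal S_0(\mathbb S^{n-1}\times\mathbb R)$ into $\mathcal S_0(\mathbb R^n)$, and both linear maps $R:\mathcal S_0(\mathbb R^n)\to\mathcal S_0(\mathbb S^{n-1}\times\mathbb R)$ and $R^{*}:\mathcal S_0(\mathbb S^{n-1}\times\mathbb R)\to\mathcal S_0(\mathbb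 R^n)$ are continuous. -/

import Mathlib

open MeasureTheory Metric
open scoped Manifold ContDiff SchwartzMap InnerProductSpace

noncomputable section

namespace RadonLizorkin

/-- The Euclidean space `ℝ^(d+1)`. -/
abbrev Euc (d : ℕ) : Type := EuclideanSpace ℝ (Fin (d + 1))

/-- The unit sphere `𝕊^d` of `ℝ^(d+1)`. -/
abbrev Sph (d : ℕ) : Type := sphere (0 : Euc d) 1

/-! ### The Lizorkin space on `ℝ^(d+1)` -/

lemma integrable_moment {d : ℕ} (m : Fin (d + 1) → ℕ) (φ : 𝓢(Euc d, ℂ)) :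
    Integrable (fun x : Euc d => ((∏ i, x i ^ m i : ℝ) : ℂ) * φ x) := by
  refine ((φ.integrable_pow_mul volume (∑ i, m i))).mono' ?_ (.of_forall fun x => ?_)
  · have h : Continuous fun x : Euc d => ((∏ i, x i ^ m i : ℝ) : ℂ) * φ x := by fun_prop
    exact h.aestronglyMeasurable
  · rw [norm_mul, Complex.norm_real, norm_prod, ← Finset.prod_pow_eq_pow_sum]
    gcongr with i
    rw [norm_pow]
    gcongr
    exact PiLp.norm_apply_le x i

/-- The Lizorkin space `𝓢₀(ℝ^(d+1))`: the Schwartz functions all of whose moments vanish, a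
subspace of the Schwartz space (with the subspace topology). -/
def lizorkin (d : ℕ) : Submodule ℂ 𝓢(Euc d, ℂ) where
  carrier := {φ | ∀ m : Fin (d + 1) → ℕ, ∫ x : Euc d, ((∏ i, x i ^ m i : ℝ) : ℂ) * φ x = 0}
  zero_mem' := by intro m; simp
  add_mem' := by
    intro φ χ hφ hχ m
    simp only [_root_.add_apply, mul_add]
    rw [integral_add (integrable_moment m φ) (integrable_moment m χ), hφ m, hχ m, add_zero]
  smul_mem' := by
    intro c φ hφ m
    simp only [_root_.smul_apply, smul_eq_mul, mul_left_comm _ c]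
    rw [integral_const_mul, hφ m, mul_zero]

/-! ### The Schwartz space on `𝕊^d × ℝ` -/

/-- Radial projection `x ↦ x / ‖x‖` of `ℝ^(d+1) ∖ {0}` onto the unit sphere. -/
def radialProj {d : ℕ} (x : Euc d) (hx : x ≠ 0) : Sph d :=
  ⟨‖x‖⁻¹ • x, by
    rw [mem_sphere_zero_iff_norm, norm_smul, norm_inv, norm_norm,
      inv_mul_cancel₀ (norm_ne_zero_iff.2 hx)]⟩

open scoped Classical in
/-- The extension of `ρ` to `ℝ^(d+1) × ℝ` that is homogeneous of degree `0` in the first variable: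
`(x, p) ↦ ρ (x / ‖x‖, p)` for `x ≠ 0` (and `0` at `x = 0`, a value that is never used). Its
derivatives at the points of `𝕊^d × ℝ` are the derivatives of `ρ` along the sphere and in `p`. -/
def homExt {d : ℕ} (ρ : Sph d × ℝ → ℂ) (y : Euc d × ℝ) : ℂ :=
  if hx : y.1 ≠ 0 then ρ (radialProj y.1 hx, y.2) else 0

/-- `ρ` is a `C^∞` function on the manifold `𝕊^d × ℝ`. -/
def IsSmooth {d : ℕ} (ρ : Sph d × ℝ → ℂ) : Prop :=
  ContMDiff ((𝓡 d).prod 𝓘(ℝ, ℝ)) 𝓘(ℝ, ℂ) ∞ ρ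

lemma homExt_contDiffAt {d : ℕ} {ρ : Sph d × ℝ → ℂ} (hρ : IsSmooth ρ) {y : Euc d × ℝ}
    (hy : y.1 ≠ 0) : ContDiffAt ℝ ∞ (homExt ρ) y := by
  have := Fact.mk (@finrank_euclideanSpace_fin ℝ _ (d + 1))
  let U : TopologicalSpace.Opens (Euc d × ℝ) :=
    ⟨{z | z.1 ≠ 0}, isOpen_ne_fun continuous_fst continuous_const⟩
  have h1 : ContMDiff 𝓘(ℝ, Euc d × ℝ) 𝓘(ℝ, Euc d) ∞
      (fun z : U => ‖(z : Euc d × ℝ).1‖⁻¹ • (z : Euc d × ℝ).1) := by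
    intro z
    have hz : ContDiffAt ℝ ∞ (fun w : Euc d × ℝ => ‖w.1‖⁻¹ • w.1) (z : Euc d × ℝ) :=
      ((contDiffAt_fst.norm ℝ z.2).inv (norm_ne_zero_iff.2 z.2)).smul contDiffAt_fst
    exact (contMDiffAt_subtype_iff (U := U) (f := fun w : Euc d × ℝ => ‖w.1‖⁻¹ • w.1)).2
      hz.contMDiffAt
  have h2 : ContMDiff 𝓘(ℝ, Euc d × ℝ) (𝓡 d) ∞ (fun z : U => radialProj (d := d) z.1.1 z.2) :=
    h1.codRestrict_sphere _
  have h3 : ContMDiff 𝓘(ℝ, Euc d × ℝ) 𝓘(ℝ, ℝ) ∞ (fun z : U => (z : Euc d × ℝ).2) := by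
    intro z
    have hz : ContDiffAt ℝ ∞ (fun w : Euc d × ℝ => w.2) (z : Euc d × ℝ) := contDiffAt_snd
    exact (contMDiffAt_subtype_iff (U := U) (f := fun w : Euc d × ℝ => w.2)).2 hz.contMDiffAt
  have h4 := hρ.comp (h2.prodMk h3)
  have h5 : (fun z : U => homExt ρ (z : Euc d × ℝ)) =
      ρ ∘ fun z : U => (radialProj (d := d) z.1.1 z.2, (z : Euc d × ℝ).2) := by
    funext z
    exact dif_pos z.2
  rw [← h5] at h4
  exact ((contMDiffAt_subtype_iff (U := U) (x := ⟨y, hy⟩)).1 (h4 ⟨y, hy⟩)).contDiffAt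

/-- The weighted size of the `m`-th derivative of `ρ` at a point of `𝕊^d × ℝ`. -/
def weight {d : ℕ} (k m : ℕ) (ρ : Sph d × ℝ → ℂ) (q : Sph d × ℝ) : ℝ :=
  (1 + |q.2|) ^ k * ‖iteratedFDeriv ℝ m (homExt ρ) ((q.1 : Euc d), q.2)‖

lemma sph_ne_zero {d : ℕ} (u : Sph d) : (u : Euc d) ≠ 0 := ne_zero_of_mem_unit_sphere u

lemma weight_nonneg {d : ℕ} (k m : ℕ) (ρ : Sph d × ℝ → ℂ) (q : Sph d × ℝ) :
    0 ≤ weight k m ρ q := by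
  unfold weight; positivity

lemma homExt_add {d : ℕ} (ρ σ : Sph d × ℝ → ℂ) : homExt (ρ + σ) = homExt ρ + homExt σ := by
  funext y; by_cases h : y.1 = 0 <;> simp [homExt, h]

lemma homExt_smul {d : ℕ} (c : ℂ) (ρ : Sph d × ℝ → ℂ) : homExt (c • ρ) = c • homExt ρ := by
  funext y; by_cases h : y.1 = 0 <;> simp [homExt, h]

lemma weight_add_le {d : ℕ} (k m : ℕ) {ρ σ : Sph d × ℝ → ℂ} (hρ : IsSmooth ρ)
    (hσ : IsSmooth σ) (q : Sph d × ℝ) :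
    weight k m (ρ + σ) q ≤ weight k m ρ q + weight k m σ q := by
  have h (τ : Sph d × ℝ → ℂ) (hτ : IsSmooth τ) :
      ContDiffAt ℝ m (homExt τ) ((q.1 : Euc d), q.2) :=
    (homExt_contDiffAt hτ (y := ((q.1 : Euc d), q.2)) (sph_ne_zero q.1)).of_le
      (mod_cast le_top)
  unfold weight
  rw [homExt_add, iteratedFDeriv_add_apply (h ρ hρ) (h σ hσ), ← mul_add]
  gcongr
  exact norm_add_le _ _

lemma weight_smul {d : ℕ} (k m : ℕ) (c : ℂ) {ρ : Sph d × ℝ → ℂ} (hρ : IsSmooth ρ)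
    (q : Sph d × ℝ) : weight k m (c • ρ) q = ‖c‖ * weight k m ρ q := by
  have h : ContDiffAt ℝ m (homExt ρ) ((q.1 : Euc d), q.2) :=
    (homExt_contDiffAt hρ (y := ((q.1 : Euc d), q.2)) (sph_ne_zero q.1)).of_le
      (mod_cast le_top)
  unfold weight
  rw [homExt_smul, iteratedFDeriv_const_smul_apply h, norm_smul]
  ring

/-- The Schwartz functions on `𝕊^d × ℝ`, as a space of functions: `ρ` is smooth, and every
derivative of `ρ` (along the sphere and in `p`, of any order and mixed) decays faster than every
power of `|p|`, uniformly on the sphere. -/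
def sphereSchwartzSubmodule (d : ℕ) : Submodule ℂ (Sph d × ℝ → ℂ) where
  carrier := {ρ | IsSmooth ρ ∧ ∀ k m : ℕ, BddAbove (Set.range (weight k m ρ))}
  zero_mem' := by
    refine ⟨contMDiff_const, fun k m => ⟨0, ?_⟩⟩
    rintro _ ⟨q, rfl⟩
    have h : (0 : Sph d × ℝ → ℂ) = (0 : ℂ) • 0 := by simp
    rw [h, weight_smul k m 0 (ρ := (0 : Sph d × ℝ → ℂ)) contMDiff_const]
    simp
  add_mem' := by
    rintro ρ σ ⟨hρ, hρ'⟩ ⟨hσ, hσ'⟩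
    refine ⟨ContMDiff.add hρ hσ, fun k m => ?_⟩
    obtain ⟨A, hA⟩ := hρ' k m
    obtain ⟨B, hB⟩ := hσ' k m
    refine ⟨A + B, ?_⟩
    rintro _ ⟨q, rfl⟩
    exact (weight_add_le k m hρ hσ q).trans (add_le_add (hA ⟨q, rfl⟩) (hB ⟨q, rfl⟩))
  smul_mem' := by
    rintro c ρ ⟨hρ, hρ'⟩
    refine ⟨(contDiff_id.const_smul c).contMDiff.comp hρ, fun k m => ?_⟩
    obtain ⟨A, hA⟩ := hρ' k m
    refine ⟨‖c‖ * A, ?_⟩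
    rintro _ ⟨q, rfl⟩
    rw [weight_smul k m c hρ]
    exact mul_le_mul_of_nonneg_left (hA ⟨q, rfl⟩) (norm_nonneg c)

/-- The Schwartz space `𝓢(𝕊^d × ℝ)`. It is a separate type, so that it does not carry the topology
of pointwise convergence; its topology is the one given by the seminorms below. -/
def SphereSchwartz (d : ℕ) : Type := ↥(sphereSchwartzSubmodule d)

namespace SphereSchwartz

instance (d : ℕ) : AddCommGroup (SphereSchwartz d) :=
  inferInstanceAs (AddCommGroup ↥(sphereSchwartzSubmodule d))

instance (d : ℕ) : Module ℂ (SphereSchwartz d) :=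
  inferInstanceAs (Module ℂ ↥(sphereSchwartzSubmodule d))

instance (d : ℕ) : CoeFun (SphereSchwartz d) (fun _ => Sph d × ℝ → ℂ) where
  coe ρ := ρ.val

variable {d : ℕ}

lemma add_apply (ρ σ : SphereSchwartz d) (q : Sph d × ℝ) : (ρ + σ) q = ρ q + σ q := rfl

lemma smul_apply (c : ℂ) (ρ : SphereSchwartz d) (q : Sph d × ℝ) : (c • ρ) q = c * ρ q := rfl

lemma zero_apply (q : Sph d × ℝ) : (0 : SphereSchwartz d) q = 0 := rfl

/-- The seminorm `sup_{u, p} (1 + |p|)^k ‖D^m ρ(u, p)‖`. -/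
protected def seminorm (d k m : ℕ) : Seminorm ℂ (SphereSchwartz d) :=
  Seminorm.of (fun ρ => ⨆ q : Sph d × ℝ, weight k m ρ q)
    (by
      intro ρ σ
      have := (NormedSpace.sphere_nonempty (E := Euc d) (x := 0) (r := 1)).2 zero_le_one
      have : Nonempty (Sph d) := this.to_subtype
      refine ciSup_le fun q => ?_
      exact (weight_add_le k m ρ.2.1 σ.2.1 q).trans
        (add_le_add (le_ciSup (ρ.2.2 k m) q) (le_ciSup (σ.2.2 k m) q)))
    (by
      intro c ρ
      rw [Real.mul_iSup_of_nonneg (norm_nonneg c)]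
      exact iSup_congr fun q => weight_smul k m c ρ.2.1 q)

/-- The family of all these seminorms. -/
def seminormFamily (d : ℕ) : SeminormFamily ℂ (SphereSchwartz d) (ℕ × ℕ) :=
  fun i => SphereSchwartz.seminorm d i.1 i.2

/-- The locally convex topology of `𝓢(𝕊^d × ℝ)` defined by the seminorms. -/
instance (d : ℕ) : TopologicalSpace (SphereSchwartz d) :=
  (seminormFamily d).moduleFilterBasis.topology'

lemma withSeminorms (d : ℕ) : WithSeminorms (seminormFamily d) := ⟨rfl⟩

instance (d : ℕ) : IsTopologicalAddGroup (SphereSchwartz d) :=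
  (seminormFamily d).addGroupFilterBasis.isTopologicalAddGroup

instance (d : ℕ) : ContinuousSMul ℂ (SphereSchwartz d) :=
  (seminormFamily d).moduleFilterBasis.continuousSMul

end SphereSchwartz

lemma sphereSchwartz_bound {d : ℕ} (ρ : SphereSchwartz d) (k : ℕ) :
    ∃ C : ℝ, ∀ (u : Sph d) (p : ℝ), (1 + |p|) ^ k * ‖ρ (u, p)‖ ≤ C := by
  obtain ⟨C, hC⟩ := ρ.2.2 k 0
  refine ⟨C, fun u p => ?_⟩
  have h := hC ⟨(u, p), rfl⟩
  have h1 : homExt ρ ((u : Euc d), p) = ρ (u, p) := by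
    have hu : radialProj (u : Euc d) (sph_ne_zero u) = u := by
      apply Subtype.ext
      simp [radialProj]
    unfold homExt
    rw [dif_pos (sph_ne_zero u), hu]
  simpa [weight, norm_iteratedFDeriv_zero, h1] using h

lemma integrable_sphere_moment {d : ℕ} (ρ : SphereSchwartz d) (u : Sph d) (k : ℕ) :
    Integrable (fun p : ℝ => (p : ℂ) ^ k * ρ (u, p)) := by
  obtain ⟨C, hC⟩ := sphereSchwartz_bound ρ (k + 2)
  have hc : Continuous ρ.val := (ρ.2.1 : IsSmooth _).continuous
  have hint : Integrable (fun p : ℝ => C * (1 + p ^ 2)⁻¹) :=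
    integrable_inv_one_add_sq.const_mul C
  refine hint.mono' ?_ (.of_forall fun p => ?_)
  · have h : Continuous fun p : ℝ => (p : ℂ) ^ k * ρ (u, p) := by
      have : Continuous fun p : ℝ => ρ.val (u, p) := by fun_prop
      exact (by fun_prop : Continuous fun p : ℝ => (p : ℂ) ^ k).mul this
    exact h.aestronglyMeasurable
  · rw [norm_mul, norm_pow, Complex.norm_real, Real.norm_eq_abs, ← div_eq_mul_inv,
      le_div_iff₀ (by positivity)]
    refine le_trans ?_ (hC u p)
    have h2 : |p| ^ k ≤ (1 + |p|) ^ k := by gcongr; linarith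
    have h3 : 1 + p ^ 2 ≤ (1 + |p|) ^ 2 := by nlinarith [sq_abs p, abs_nonneg p]
    calc |p| ^ k * ‖ρ (u, p)‖ * (1 + p ^ 2)
        ≤ (1 + |p|) ^ k * ‖ρ (u, p)‖ * (1 + |p|) ^ 2 := by gcongr
      _ = (1 + |p|) ^ (k + 2) * ‖ρ (u, p)‖ := by ring

/-- The Lizorkin space `𝓢₀(𝕊^d × ℝ)`: the `ρ ∈ 𝓢(𝕊^d × ℝ)` such that all moments of `ρ(u, ·)`
vanish for every `u ∈ 𝕊^d` (with the subspace topology). -/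
def sphereLizorkin (d : ℕ) : Submodule ℂ (SphereSchwartz d) where
  carrier := {ρ | ∀ (u : Sph d) (k : ℕ), ∫ p : ℝ, (p : ℂ) ^ k * ρ (u, p) = 0}
  zero_mem' := by intro u k; simp [SphereSchwartz.zero_apply]
  add_mem' := by
    intro ρ σ hρ hσ u k
    simp only [SphereSchwartz.add_apply, mul_add]
    rw [integral_add (integrable_sphere_moment ρ u k) (integrable_sphere_moment σ u k),
      hρ u k, hσ u k, add_zero]
  smul_mem' := by
    intro c ρ hρ u k
    simp only [SphereSchwartz.smul_apply, mul_left_comm _ c]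
    rw [integral_const_mul, hρ u k, mul_zero]

/-! ### The two transforms -/

/-- The Radon transform `Rf(u, p) = ∫_{x·u = p} f(x) dx`: the integral of `f` over the hyperplane
`{x | x·u = p}` of `ℝ^(d+1)` with respect to its `d`-dimensional Lebesgue measure, which is the
Euclidean (normalized) `d`-dimensional Hausdorff measure. -/
def radon {d : ℕ} (f : Euc d → ℂ) (q : Sph d × ℝ) : ℂ :=
  ∫ x in {x : Euc d | ⟪x, (q.1 : Euc d)⟫_ℝ = q.2}, f x ∂μHE[d]

/-- The dual Radon transform `R*ρ(x) = ∫_{𝕊^d} ρ(u, x·u) du`, with respect to the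
(unnormalized) surface measure of the sphere. -/
def dualRadon {d : ℕ} (ρ : Sph d × ℝ → ℂ) (x : Euc d) : ℂ :=
  ∫ u : Sph d, ρ (u, ⟪x, (u : Euc d)⟫_ℝ) ∂(volume : Measure (Euc d)).toSphere

end RadonLizorkin

end

/-! Functions on the sphere are handled through their extensions of degree 0, so all calculus takes
place on an open subset of a vector space. A recurring device controls derivatives of every order:
if the first derivatives of `Q v` are combinations of `Q (T i v)` with continuous operators `T i`
and coefficients of polynomial growth, then induction gives smoothness, and sup bounds on the values
alone give every seminorm estimate (`contDiffOn_homExt_of_deriv_formula`,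
`boundedBySeminorm_weight_of_deriv_formula`).

For R, the Fourier slice theorem gives Rφ(u, p) = ∫ exp(2πiσp) φ̂(σu) dσ, so the dependence on u is
that of a Schwartz function along rays. Every derivative produces a factor σ, and σ = ∑ u_l (σ u_l)
turns it into multiplication of φ̂ by coordinates: the family is closed under differentiation
(`hasFDerivAt_integral_rayIntegrand`). The sup bounds come from the hyperplane integral, whose
weight splits between p and the hyperplane. This gives continuity on all Schwartz functions; Fubini
and the multinomial formula transfer the vanishing moments.

For R*, differentiation is easy: ∂_j R*ρ = R*(u_j ∂_p ρ). Decay is the difficulty. Let Ψ be the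
primitive of ρ in p; the vanishing moments of ρ make Ψ again an element of the Lizorkin space,
depending continuously on ρ (`primitive`). Integration by parts on the sphere
(`integral_sphere_fderiv`), applied to Ψ(u, x·u), gives x_j R*ρ = R*(u_j p ρ + d u_j Ψ - ∇_j Ψ)
(`dualRadonₗ_coordMul`). Hence powers of x and derivatives are absorbed into continuous operators
acting on ρ, and the trivial bound of R* by the area of the sphere controls all Schwartz seminorms.
Monomials are absorbed in the same way, so only the total integral of R*ρ remains; it is zero
because R*ρ = ∑ ∂_j R*(u_j Ψ) is a divergence of Schwartz functions (`integral_dualRadonₗ`). -/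

noncomputable section

namespace RadonLizorkin

/-! ### Estimates by continuous seminorms -/

section Seminorms

variable {V W α β : Type*} [AddCommGroup V] [Module ℂ V] [TopologicalSpace V]
  [AddCommGroup W] [Module ℂ W] [TopologicalSpace W]

/-- The quantities `b v a` are bounded, uniformly in `a`, by a continuous seminorm of `v`. -/
def BoundedBySeminorm (b : V → α → ℝ) : Prop :=
  ∃ q : Seminorm ℂ V, Continuous q ∧ ∀ v a, b v a ≤ q v

namespace BoundedBySeminorm

lemma mono {b : V → α → ℝ} {c : V → β → ℝ} (hb : BoundedBySeminorm b)
    (h : ∀ v x, ∃ a, c v x ≤ b v a) : BoundedBySeminorm c := by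
  obtain ⟨q, hq, hbq⟩ := hb
  refine ⟨q, hq, fun v x => ?_⟩
  obtain ⟨a, ha⟩ := h v x
  exact ha.trans (hbq v a)

lemma of_le {b c : V → α → ℝ} (hb : BoundedBySeminorm b) (h : ∀ v a, c v a ≤ b v a) :
    BoundedBySeminorm c :=
  hb.mono fun v a => ⟨a, h v a⟩

lemma const_mul {b : V → α → ℝ} (hb : BoundedBySeminorm b) {C : ℝ} (hC : 0 ≤ C) :
    BoundedBySeminorm fun v a => C * b v a := by
  obtain ⟨q, hq, hbq⟩ := hb
  refine ⟨(C.toNNReal) • q, ?_, fun v a => ?_⟩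
  · rw [FunLike.coe_smul]
    exact hq.const_smul _
  · rw [FunLike.coe_smul, Pi.smul_apply, NNReal.smul_def, Real.coe_toNNReal C hC, smul_eq_mul]
    exact mul_le_mul_of_nonneg_left (hbq v a) hC

lemma add {b c : V → α → ℝ} (hb : BoundedBySeminorm b) (hc : BoundedBySeminorm c) :
    BoundedBySeminorm fun v a => b v a + c v a := by
  obtain ⟨q, hq, hbq⟩ := hb
  obtain ⟨r, hr, hcr⟩ := hc
  refine ⟨q + r, ?_, fun v a => add_le_add (hbq v a) (hcr v a)⟩
  rw [FunLike.coe_add]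
  exact hq.add hr

lemma zero : BoundedBySeminorm fun (_ : V) (_ : α) => (0 : ℝ) :=
  ⟨0, continuous_const, fun _ _ => le_rfl⟩

lemma sum {ι : Type*} (s : Finset ι) {b : ι → V → α → ℝ}
    (hb : ∀ i ∈ s, BoundedBySeminorm (b i)) :
    BoundedBySeminorm fun v a => ∑ i ∈ s, b i v a := by
  classical
  induction s using Finset.induction_on with
  | empty => simpa using zero
  | insert i s hi ih =>
    simp only [Finset.sum_insert hi]
    exact (hb i (Finset.mem_insert_self i s)).add
      (ih fun j hj => hb j (Finset.mem_insert_of_mem hj))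

lemma comp {b : W → α → ℝ} (hb : BoundedBySeminorm b) (T : V →L[ℂ] W) :
    BoundedBySeminorm fun v a => b (T v) a := by
  obtain ⟨q, hq, hbq⟩ := hb
  exact ⟨q.comp T.toLinearMap, hq.comp T.continuous, fun v a => hbq (T v) a⟩

end BoundedBySeminorm

lemma boundedBySeminorm_schwartz {E : Type*} [NormedAddCommGroup E] [NormedSpace ℝ E] (k m : ℕ) :
    BoundedBySeminorm fun (φ : 𝓢(E, ℂ)) (x : E) =>
      (1 + ‖x‖) ^ k * ‖iteratedFDeriv ℝ m φ x‖ := by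
  refine ⟨(2 ^ k : NNReal) •
    (Finset.Iic (k, m)).sup fun i => SchwartzMap.seminorm ℂ i.1 i.2, ?_, fun φ x => ?_⟩
  · rw [FunLike.coe_smul]
    exact (Seminorm.continuous_finsetSup fun i _ =>
      (schwartz_withSeminorms ℂ E ℂ).continuous_seminorm i).const_smul _
  · have := SchwartzMap.one_add_le_sup_seminorm_apply (𝕜 := ℂ) (m := (k, m)) le_rfl le_rfl φ x
    simpa [NNReal.smul_def] using this

end Seminorms

variable {d : ℕ}

/-! ### Homogeneous extensions -/

/-- The set of the `(x, p)` with `x ≠ 0`. -/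
def offAxis (d : ℕ) : Set (Euc d × ℝ) := {y | y.1 ≠ 0}

lemma isOpen_offAxis : IsOpen (offAxis d) := isOpen_ne_fun continuous_fst continuous_const

lemma sph_mem_offAxis (u : Sph d) (p : ℝ) : ((u : Euc d), p) ∈ offAxis d := sph_ne_zero u

lemma norm_sph (u : Sph d) : ‖(u : Euc d)‖ = 1 := norm_eq_of_mem_sphere u

lemma norm_sph_prod_le (u : Sph d) (p : ℝ) : ‖((u : Euc d), p)‖ ≤ 1 + |p| := by
  rw [Prod.norm_def, norm_sph, Real.norm_eq_abs]
  exact max_le (by linarith [abs_nonneg p]) (by linarith)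

lemma homExt_of_ne (ρ : Sph d × ℝ → ℂ) {x : Euc d} (hx : x ≠ 0) (p : ℝ) :
    homExt ρ (x, p) = ρ (radialProj x hx, p) := dif_pos hx

lemma homExt_sph (ρ : Sph d × ℝ → ℂ) (u : Sph d) (p : ℝ) :
    homExt ρ ((u : Euc d), p) = ρ (u, p) := by
  have hu : radialProj (u : Euc d) (sph_ne_zero u) = u := by
    apply Subtype.ext
    simp [radialProj]
  rw [homExt_of_ne ρ (sph_ne_zero u), hu]

lemma homExt_smul_fst (ρ : Sph d × ℝ → ℂ) {r : ℝ} (hr : 0 < r) (x : Euc d) (p : ℝ) :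
    homExt ρ (r • x, p) = homExt ρ (x, p) := by
  by_cases hx : x = 0
  · simp [hx]
  · have hrx : r • x ≠ 0 := smul_ne_zero hr.ne' hx
    rw [homExt_of_ne ρ hrx, homExt_of_ne ρ hx]
    congr 2
    apply Subtype.ext
    simp only [radialProj, norm_smul, Real.norm_eq_abs, abs_of_pos hr, smul_smul]
    congr 1
    field_simp

/-- A function on `𝕊^d × ℝ` is smooth if it extends to a smooth function. -/
lemma isSmooth_of_contDiffOn {F : Euc d × ℝ → ℂ} (hF : ContDiffOn ℝ ∞ F (offAxis d)) :
    IsSmooth fun q : Sph d × ℝ => F ((q.1 : Euc d), q.2) := by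
  have := Fact.mk (@finrank_euclideanSpace_fin ℝ _ (d + 1))
  intro q
  have h1 : ContMDiff ((𝓡 d).prod 𝓘(ℝ, ℝ)) 𝓘(ℝ, Euc d × ℝ) ∞
      (fun q : Sph d × ℝ => ((q.1 : Euc d), q.2)) :=
    (contMDiff_coe_sphere.comp contMDiff_fst).prodMk_space contMDiff_snd
  have h2 : ContMDiffAt 𝓘(ℝ, Euc d × ℝ) 𝓘(ℝ, ℂ) ∞ F ((q.1 : Euc d), q.2) :=
    (hF.contDiffAt (isOpen_offAxis.mem_nhds (sph_mem_offAxis q.1 q.2))).contMDiffAt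
  exact h2.comp q (h1 q)

/-- Together with `IsSmooth.contDiffOn`, this trades smoothness on the manifold for smoothness on an
open set of a vector space, so no charts are needed from here on. -/
lemma isSmooth_of_contDiffOn_homExt {ρ : Sph d × ℝ → ℂ}
    (h : ContDiffOn ℝ ∞ (homExt ρ) (offAxis d)) : IsSmooth ρ := by
  have := isSmooth_of_contDiffOn h
  simp only [homExt_sph] at this
  exact this

lemma IsSmooth.contDiffOn {ρ : Sph d × ℝ → ℂ} (h : IsSmooth ρ) :
    ContDiffOn ℝ ∞ (homExt ρ) (offAxis d) :=
  fun _ hy => (homExt_contDiffAt h hy).contDiffWithinAt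

/-- A map into `𝓢(𝕊^d × ℝ)` is a continuous linear map if it satisfies the seminorm estimates. -/
def SphereSchwartz.mkCLM {V : Type*} [AddCommGroup V] [Module ℂ V] [TopologicalSpace V]
    [IsTopologicalAddGroup V] (Q : V →ₗ[ℂ] (Sph d × ℝ → ℂ)) (hs : ∀ v, IsSmooth (Q v))
    (hb : ∀ k m, BoundedBySeminorm fun v q => weight k m (Q v) q) : V →L[ℂ] SphereSchwartz d :=
  let L : V →ₗ[ℂ] SphereSchwartz d := Q.codRestrict (sphereSchwartzSubmodule d) fun v =>
    ⟨hs v, fun k m => by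
      obtain ⟨q, -, hq⟩ := hb k m
      exact ⟨q v, by rintro _ ⟨x, rfl⟩; exact hq v x⟩⟩
  ⟨L, by
    have := (NormedSpace.sphere_nonempty (E := Euc d) (x := 0) (r := 1)).2 zero_le_one
    have : Nonempty (Sph d) := this.to_subtype
    refine (SphereSchwartz.withSeminorms d).continuous_of_continuous_comp L fun i => ?_
    obtain ⟨q, hqc, hq⟩ := hb i.1 i.2
    exact Seminorm.continuous_of_le hqc fun v => ciSup_le fun x => hq v x⟩

lemma boundedBySeminorm_weight (d k m : ℕ) :
    BoundedBySeminorm fun (ρ : SphereSchwartz d) (q : Sph d × ℝ) => weight k m ρ q :=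
  ⟨SphereSchwartz.seminormFamily d (k, m), (SphereSchwartz.withSeminorms d).continuous_seminorm _,
    fun ρ q => le_ciSup (ρ.2.2 k m) q⟩

lemma boundedBySeminorm_apply (d k : ℕ) :
    BoundedBySeminorm fun (ρ : SphereSchwartz d) (q : Sph d × ℝ) =>
      (1 + |q.2|) ^ k * ‖ρ q‖ := by
  refine (boundedBySeminorm_weight d k 0).of_le fun ρ q => ?_
  rw [weight, norm_iteratedFDeriv_zero, homExt_sph]

/-! ### Multipliers -/

/-- Smooth functions all of whose derivatives grow at most polynomially on `𝕊^d × ℝ`. -/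
structure IsMultiplier {W : Type*} [NormedAddCommGroup W] [NormedSpace ℝ W]
    (a : Euc d × ℝ → W) : Prop where
  smooth : ContDiffOn ℝ ∞ a (offAxis d)
  growth : ∀ m : ℕ, ∃ l : ℕ, ∃ C : ℝ, 0 ≤ C ∧
    ∀ (u : Sph d) (p : ℝ), ‖iteratedFDeriv ℝ m a ((u : Euc d), p)‖ ≤ C * (1 + |p|) ^ l

section Multiplier

variable {W : Type*} [NormedAddCommGroup W] [NormedSpace ℝ W]

lemma IsMultiplier.congr {a b : Euc d × ℝ → W} (ha : IsMultiplier a)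
    (h : Set.EqOn b a (offAxis d)) : IsMultiplier b := by
  refine ⟨ha.smooth.congr h, fun m => ?_⟩
  obtain ⟨l, C, hC, hl⟩ := ha.growth m
  refine ⟨l, C, hC, fun u p => ?_⟩
  have he : b =ᶠ[nhds ((u : Euc d), p)] a :=
    Filter.eventuallyEq_of_mem (isOpen_offAxis.mem_nhds (sph_mem_offAxis u p)) h
  rw [(he.iteratedFDeriv ℝ m).self_of_nhds]
  exact hl u p

lemma isMultiplier_of_hasTemperateGrowth {a : Euc d × ℝ → W} (ha : a.HasTemperateGrowth) :
    IsMultiplier a := by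
  refine ⟨ha.1.contDiffOn, fun m => ?_⟩
  obtain ⟨k, C, h⟩ := ha.2 m
  have hC : 0 ≤ C := by
    have := (norm_nonneg _).trans (h 0)
    simpa using this
  refine ⟨k, 2 ^ k * C, by positivity, fun u p => (h _).trans ?_⟩
  calc C * (1 + ‖((u : Euc d), p)‖) ^ k ≤ C * (2 * (1 + |p|)) ^ k := by
        gcongr
        linarith [norm_sph_prod_le u p, abs_nonneg p]
    _ = 2 ^ k * C * (1 + |p|) ^ k := by rw [mul_pow]; ring

/-- Growth is only measured over the unit sphere, which is compact and avoids the singularity at 0.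
Nothing depends on `p`, so the exponent is 0. -/
lemma isMultiplier_comp_fst {b : Euc d → W} (hb : ContDiffOn ℝ ∞ b {0}ᶜ) :
    IsMultiplier fun y : Euc d × ℝ => b y.1 := by
  have ho : IsOpen ({0}ᶜ : Set (Euc d)) := isOpen_compl_singleton
  refine ⟨hb.comp contDiff_fst.contDiffOn fun y hy => hy, fun m => ?_⟩
  have hc : ContinuousOn (iteratedFDeriv ℝ m b) (sphere 0 1) := by
    intro x hx
    have hx0 : x ∈ ({0}ᶜ : Set (Euc d)) := ne_zero_of_mem_unit_sphere ⟨x, hx⟩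
    exact ((hb.contDiffAt (ho.mem_nhds hx0)).continuousAt_iteratedFDeriv
      (mod_cast le_top)).continuousWithinAt
  obtain ⟨C, hC⟩ := (isCompact_sphere (0 : Euc d) 1).exists_bound_of_continuousOn hc
  refine ⟨0, |C| * ‖ContinuousLinearMap.fst ℝ (Euc d) ℝ‖ ^ m, by positivity, fun u p => ?_⟩
  have hU : IsOpen ((ContinuousLinearMap.fst ℝ (Euc d) ℝ) ⁻¹' ({0}ᶜ : Set (Euc d))) :=
    ho.preimage (ContinuousLinearMap.continuous _)
  have h := (ContinuousLinearMap.fst ℝ (Euc d) ℝ).iteratedFDerivWithin_comp_right hb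
    ho.uniqueDiffOn hU.uniqueDiffOn (x := ((u : Euc d), p)) (sph_ne_zero u) (i := m)
    (mod_cast le_top)
  rw [iteratedFDerivWithin_of_isOpen m hU (sph_mem_offAxis u p),
    ContinuousLinearMap.coe_fst', iteratedFDerivWithin_of_isOpen m ho (sph_ne_zero u)] at h
  change ‖iteratedFDeriv ℝ m (b ∘ Prod.fst) ((u : Euc d), p)‖ ≤ _
  rw [h, pow_zero, mul_one]
  refine (ContinuousMultilinearMap.norm_compContinuousLinearMap_le _ _).trans ?_
  rw [Finset.prod_const, Finset.card_univ, Fintype.card_fin]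
  gcongr
  exact (hC _ u.2).trans (le_abs_self C)

variable [NormedSpace ℂ W] [IsScalarTower ℝ ℂ W]

/-- The derivatives of a product with a multiplier. -/
lemma IsMultiplier.exists_norm_iteratedFDeriv_smul_le {a : Euc d × ℝ → W} (ha : IsMultiplier a)
    (m : ℕ) : ∃ l : ℕ, ∃ C : ℝ, 0 ≤ C ∧ ∀ G : Euc d × ℝ → ℂ, ContDiffOn ℝ ∞ G (offAxis d) →
      ∀ (u : Sph d) (p : ℝ), ‖iteratedFDeriv ℝ m (fun y => G y • a y) ((u : Euc d), p)‖ ≤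
        ∑ i ∈ Finset.range (m + 1),
          C * ((1 + |p|) ^ l * ‖iteratedFDeriv ℝ i G ((u : Euc d), p)‖) := by
  choose l C hC h using ha.growth
  -- One exponent and one constant must serve every term of the Leibniz rule; the sums dominate each
  -- of their nonnegative terms, and 1 + |p| ≥ 1. Neither depends on `G`, as a seminorm estimate
  -- requires.
  refine ⟨∑ j ∈ Finset.range (m + 1), l j, ∑ j ∈ Finset.range (m + 1), (m.choose j) * C (m - j),
    Finset.sum_nonneg fun j _ => mul_nonneg (by positivity) (hC _), fun G hG u p => ?_⟩
  have hu := sph_mem_offAxis u p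
  have key := norm_iteratedFDerivWithin_smul_le hG ha.smooth isOpen_offAxis.uniqueDiffOn hu
    (n := m) (mod_cast le_top)
  simp only [iteratedFDerivWithin_of_isOpen _ isOpen_offAxis hu] at key
  refine key.trans (Finset.sum_le_sum fun i hi => ?_)
  have hi' : i ≤ m := Nat.lt_succ_iff.1 (Finset.mem_range.1 hi)
  have h1 : (m.choose i : ℝ) * C (m - i) ≤
      ∑ j ∈ Finset.range (m + 1), (m.choose j : ℝ) * C (m - j) :=
    Finset.single_le_sum (f := fun j => (m.choose j : ℝ) * C (m - j))
      (fun j _ => mul_nonneg (by positivity) (hC _)) hi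
  have h2 : l (m - i) ≤ ∑ j ∈ Finset.range (m + 1), l j :=
    Finset.single_le_sum (fun j _ => Nat.zero_le _)
      (Finset.mem_range.2 (by omega : m - i < m + 1))
  calc (m.choose i : ℝ) * ‖iteratedFDeriv ℝ i G ((u : Euc d), p)‖ *
        ‖iteratedFDeriv ℝ (m - i) a ((u : Euc d), p)‖
      ≤ (m.choose i : ℝ) * ‖iteratedFDeriv ℝ i G ((u : Euc d), p)‖ *
        (C (m - i) * (1 + |p|) ^ l (m - i)) := by gcongr; exact h _ u p
    _ = ((m.choose i : ℝ) * C (m - i)) * ((1 + |p|) ^ l (m - i) *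
        ‖iteratedFDeriv ℝ i G ((u : Euc d), p)‖) := by ring
    _ ≤ _ := by
        gcongr
        · exact (mul_nonneg (by positivity) (hC _)).trans h1
        · linarith [abs_nonneg p]

end Multiplier

/-! ### Families of functions closed under differentiation -/

section DerivFormula

variable {V ι : Type*} [Fintype ι]

/-- Bootstrap: if all members of the family are of class C^n, the formula shows that all their
derivatives are too, so all members are of class C^(n+1). The induction has to run over all `v` at
once. -/
lemma contDiffOn_homExt_of_deriv_formula {Q : V → (Sph d × ℝ → ℂ)} {T : ι → V → V}
    {a : ι → Euc d × ℝ → (Euc d × ℝ →L[ℝ] ℂ)} (ha : ∀ i, IsMultiplier (a i))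
    (hQ : ∀ v, ∀ y ∈ offAxis d,
      HasFDerivAt (homExt (Q v)) (∑ i, homExt (Q (T i v)) y • a i y) y) (v : V) :
    ContDiffOn ℝ ∞ (homExt (Q v)) (offAxis d) := by
  refine contDiffOn_infty.2 fun n => ?_
  induction n generalizing v with
  | zero =>
    exact contDiffOn_zero.2 fun y hy => (hQ v y hy).continuousAt.continuousWithinAt
  | succ n ih =>
    rw [Nat.cast_add, Nat.cast_one, contDiffOn_succ_iff_fderiv_of_isOpen isOpen_offAxis]
    refine ⟨fun y hy => (hQ v y hy).differentiableAt.differentiableWithinAt, by simp, ?_⟩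
    have h : ContDiffOn ℝ n (fun y => ∑ i, homExt (Q (T i v)) y • a i y) (offAxis d) :=
      ContDiffOn.sum fun i _ => (ih _).smul ((ha i).smooth.of_le (mod_cast le_top))
    exact h.congr fun y hy => (hQ v y hy).fderiv

variable [AddCommGroup V] [Module ℂ V] [TopologicalSpace V]

/-- The derivative of order m + 1 is the derivative of order m of the formula. By the Leibniz rule
this involves orders j ≤ m of the functions `Q (T i v)`, with a higher power of 1 + |p| to pay for
the growth of the coefficients; hence the strong induction with `k` free. Continuity of `T i` turns
a seminorm of `T i v` into one of `v`. -/
lemma boundedBySeminorm_weight_of_deriv_formula {Q : V → (Sph d × ℝ → ℂ)} {T : ι → V →L[ℂ] V}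
    {a : ι → Euc d × ℝ → (Euc d × ℝ →L[ℝ] ℂ)} (ha : ∀ i, IsMultiplier (a i))
    (hQ : ∀ v, ∀ y ∈ offAxis d,
      HasFDerivAt (homExt (Q v)) (∑ i, homExt (Q (T i v)) y • a i y) y)
    (hb : ∀ k, BoundedBySeminorm fun v (q : Sph d × ℝ) => (1 + |q.2|) ^ k * ‖Q v q‖) (k m : ℕ) :
    BoundedBySeminorm fun v q => weight k m (Q v) q := by
  have hs := contDiffOn_homExt_of_deriv_formula (T := fun i v => T i v) ha hQ
  induction m using Nat.strong_induction_on generalizing k with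
  | _ m ih =>
    cases m with
    | zero =>
      refine (hb k).of_le fun v q => ?_
      rw [weight, norm_iteratedFDeriv_zero, homExt_sph]
    | succ m =>
      choose l C hC h using fun i => (ha i).exists_norm_iteratedFDeriv_smul_le m
      have key : BoundedBySeminorm fun v (q : Sph d × ℝ) => ∑ i, ∑ j ∈ Finset.range (m + 1),
          C i * weight (k + l i) j (Q (T i v)) q :=
        BoundedBySeminorm.sum _ fun i _ => BoundedBySeminorm.sum _ fun j hj =>
          ((ih j (Finset.mem_range.1 hj) (k + l i)).comp (T i)).const_mul (hC i)
      refine key.of_le fun v q => ?_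
      obtain ⟨u, p⟩ := q
      have hu := sph_mem_offAxis u p
      have he : fderiv ℝ (homExt (Q v)) =ᶠ[nhds ((u : Euc d), p)]
          fun y => ∑ i, homExt (Q (T i v)) y • a i y :=
        Filter.eventuallyEq_of_mem (isOpen_offAxis.mem_nhds hu) fun y hy => (hQ v y hy).fderiv
      have hc (i : ι) (_ : i ∈ Finset.univ) :
          ContDiffAt ℝ m (fun y => homExt (Q (T i v)) y • a i y) ((u : Euc d), p) :=
        (((hs (T i v)).smul (ha i).smooth).contDiffAt (isOpen_offAxis.mem_nhds hu)).of_le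
          (mod_cast le_top)
      rw [weight, ← norm_iteratedFDeriv_fderiv, (he.iteratedFDeriv ℝ m).self_of_nhds,
        iteratedFDeriv_fun_sum_apply hc]
      calc (1 + |p|) ^ k * ‖∑ i, iteratedFDeriv ℝ m (fun y => homExt (Q (T i v)) y • a i y)
              ((u : Euc d), p)‖
          ≤ (1 + |p|) ^ k * ∑ i, ∑ j ∈ Finset.range (m + 1), C i * ((1 + |p|) ^ l i *
              ‖iteratedFDeriv ℝ j (homExt (Q (T i v))) ((u : Euc d), p)‖) := by
            gcongr
            exact (norm_sum_le _ _).trans (Finset.sum_le_sum fun i _ => h i _ (hs _) u p)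
        _ = _ := by
            simp only [Finset.mul_sum, weight, pow_add]
            refine Finset.sum_congr rfl fun i _ => Finset.sum_congr rfl fun j _ => ?_
            ring

/-- A linear map into functions on `𝕊^d × ℝ` that satisfies sup estimates is continuous into
`𝓢(𝕊^d × ℝ)` if the derivatives of its values are combinations of its values. -/
def SphereSchwartz.mkCLMOfDeriv [IsTopologicalAddGroup V] (Q : V →ₗ[ℂ] (Sph d × ℝ → ℂ))
    (T : ι → V →L[ℂ] V) {a : ι → Euc d × ℝ → (Euc d × ℝ →L[ℝ] ℂ)} (ha : ∀ i, IsMultiplier (a i))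
    (hQ : ∀ v, ∀ y ∈ offAxis d,
      HasFDerivAt (homExt (Q v)) (∑ i, homExt (Q (T i v)) y • a i y) y)
    (hb : ∀ k, BoundedBySeminorm fun v (q : Sph d × ℝ) => (1 + |q.2|) ^ k * ‖Q v q‖) :
    V →L[ℂ] SphereSchwartz d :=
  SphereSchwartz.mkCLM Q
    (fun v => isSmooth_of_contDiffOn_homExt
      (contDiffOn_homExt_of_deriv_formula (T := fun i v => T i v) ha hQ v))
    (boundedBySeminorm_weight_of_deriv_formula ha hQ hb)

end DerivFormula

/-! ### Multiplication operators and derivatives -/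

namespace SphereSchwartz

lemma contDiffOn (ρ : SphereSchwartz d) : ContDiffOn ℝ ∞ (homExt ρ) (offAxis d) :=
  (show IsSmooth ρ.val from ρ.2.1).contDiffOn

lemma differentiableAt (ρ : SphereSchwartz d) {y : Euc d × ℝ} (hy : y ∈ offAxis d) :
    DifferentiableAt ℝ (homExt ρ) y :=
  (ρ.contDiffOn.contDiffAt (isOpen_offAxis.mem_nhds hy)).differentiableAt (by simp)

lemma continuous (ρ : SphereSchwartz d) : Continuous (ρ : Sph d × ℝ → ℂ) :=
  (show IsSmooth ρ.val from ρ.2.1).continuous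

lemma homExt_mul (a ρ : Sph d × ℝ → ℂ) :
    homExt (fun q => a q * ρ q) = fun y => homExt ρ y • homExt a y := by
  funext y; by_cases h : y.1 = 0 <;> simp [homExt, h, mul_comm]

/-- Multiplication by a function. -/
def mulCLM (a : Sph d × ℝ → ℂ) (ha : IsMultiplier (homExt a)) :
    SphereSchwartz d →L[ℂ] SphereSchwartz d :=
  SphereSchwartz.mkCLM
    { toFun := fun ρ q => a q * ρ q
      map_add' := fun ρ σ => by funext q; simp [add_apply, mul_add]
      map_smul' := fun c ρ => by funext q; simp [smul_apply, mul_left_comm] }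
    (fun ρ => by
      refine isSmooth_of_contDiffOn_homExt ?_
      simp only [LinearMap.coe_mk, AddHom.coe_mk, homExt_mul]
      exact ρ.contDiffOn.smul ha.smooth)
    (fun k m => by
      obtain ⟨l, C, hC, h⟩ := ha.exists_norm_iteratedFDeriv_smul_le m
      have key : BoundedBySeminorm fun (ρ : SphereSchwartz d) (q : Sph d × ℝ) =>
          ∑ j ∈ Finset.range (m + 1), C * weight (k + l) j ρ q :=
        BoundedBySeminorm.sum _ fun j _ => (boundedBySeminorm_weight d (k + l) j).const_mul hC
      refine key.of_le fun ρ q => ?_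
      simp only [LinearMap.coe_mk, AddHom.coe_mk, homExt_mul, weight]
      refine (mul_le_mul_of_nonneg_left (h _ ρ.contDiffOn q.1 q.2) (by positivity)).trans_eq ?_
      simp only [Finset.mul_sum, pow_add]
      refine Finset.sum_congr rfl fun j _ => ?_
      ring)

lemma isMultiplier_normalize_coord (j : Fin (d + 1)) :
    ContDiffOn ℝ ∞ (fun x : Euc d => ‖x‖⁻¹ * x j) {0}ᶜ := by
  intro x hx
  have h1 : ContDiffAt ℝ ∞ (fun x : Euc d => ‖x‖⁻¹) x :=
    (contDiffAt_norm ℝ hx).inv (norm_ne_zero_iff.2 hx)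
  have h2 : ContDiff ℝ ∞ (fun x : Euc d => x j) :=
    (EuclideanSpace.proj j : Euc d →L[ℝ] ℝ).contDiff
  exact (h1.mul h2.contDiffAt).contDiffWithinAt

lemma isMultiplier_coord (j : Fin (d + 1)) :
    IsMultiplier (homExt fun q : Sph d × ℝ => (((q.1 : Euc d) j : ℝ) : ℂ)) := by
  refine (isMultiplier_comp_fst
    (Complex.ofRealCLM.contDiff.comp_contDiffOn (isMultiplier_normalize_coord j))).congr ?_
  rintro ⟨x, p⟩ hx
  rw [homExt_of_ne _ hx]
  simp [radialProj]

/-- Multiplication by the coordinate `u_j`. -/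
def mulCoord (j : Fin (d + 1)) : SphereSchwartz d →L[ℂ] SphereSchwartz d :=
  mulCLM _ (isMultiplier_coord j)

lemma mulCoord_apply (j : Fin (d + 1)) (ρ : SphereSchwartz d) (q : Sph d × ℝ) :
    mulCoord j ρ q = (((q.1 : Euc d) j : ℝ) : ℂ) * ρ q := rfl

lemma isMultiplier_snd : IsMultiplier (homExt fun q : Sph d × ℝ => (q.2 : ℂ)) := by
  refine (isMultiplier_of_hasTemperateGrowth
    (Complex.ofRealCLM.comp (ContinuousLinearMap.snd ℝ (Euc d) ℝ)).hasTemperateGrowth).congr ?_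
  rintro ⟨x, p⟩ hx
  rw [homExt_of_ne _ hx]
  simp

/-- Multiplication by `p`. -/
def mulSnd (d : ℕ) : SphereSchwartz d →L[ℂ] SphereSchwartz d := mulCLM _ isMultiplier_snd

lemma mulSnd_apply (ρ : SphereSchwartz d) (q : Sph d × ℝ) : mulSnd d ρ q = (q.2 : ℂ) * ρ q := rfl

/-- Chain rule for the dilation `A` of the first variable, which leaves the extension invariant.
Thus derivatives in x are homogeneous of degree -1 and the derivative in p is homogeneous of degree
0. -/
lemma fderiv_homExt_smul_fst (ρ : SphereSchwartz d) {r : ℝ} (hr : 0 < r) {x : Euc d} (hx : x ≠ 0)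
    (p : ℝ) (w : Euc d × ℝ) :
    fderiv ℝ (homExt ρ) (r • x, p) (r • w.1, w.2) = fderiv ℝ (homExt ρ) (x, p) w := by
  let A : Euc d × ℝ →L[ℝ] Euc d × ℝ :=
    (r • ContinuousLinearMap.fst ℝ (Euc d) ℝ).prod (ContinuousLinearMap.snd ℝ (Euc d) ℝ)
  have h1 : homExt (ρ : Sph d × ℝ → ℂ) ∘ A = homExt ρ := by
    funext y
    exact homExt_smul_fst ρ hr y.1 y.2
  have h2 : HasFDerivAt (homExt (ρ : Sph d × ℝ → ℂ)) (fderiv ℝ (homExt ρ) (r • x, p)) (A (x, p)) :=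
    (ρ.differentiableAt (smul_ne_zero hr.ne' hx : r • x ≠ 0)).hasFDerivAt
  have h3 := h2.comp (x, p) A.hasFDerivAt
  rw [h1] at h3
  rw [h3.fderiv]
  rfl

lemma contDiffOn_fderiv_apply (ρ : SphereSchwartz d) (w : Euc d × ℝ) :
    ContDiffOn ℝ ∞ (fun y => fderiv ℝ (homExt ρ) y w) (offAxis d) :=
  (ρ.contDiffOn.fderiv_of_isOpen isOpen_offAxis (m := ∞) (by simp)).clm_apply contDiffOn_const

lemma norm_iteratedFDeriv_fderiv_apply_le (ρ : SphereSchwartz d) (w : Euc d × ℝ) (m : ℕ)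
    {y : Euc d × ℝ} (hy : y ∈ offAxis d) :
    ‖iteratedFDeriv ℝ m (fun y => fderiv ℝ (homExt ρ) y w) y‖ ≤
      ‖w‖ * ‖iteratedFDeriv ℝ (m + 1) (homExt ρ) y‖ := by
  rw [← norm_iteratedFDeriv_fderiv]
  have h1 : ContDiffAt ℝ m (fderiv ℝ (homExt ρ)) y :=
    ((ρ.contDiffOn.fderiv_of_isOpen isOpen_offAxis (m := ∞) (by simp)).contDiffAt
      (isOpen_offAxis.mem_nhds hy)).of_le (mod_cast le_top)
  have h2 := (ContinuousLinearMap.apply ℝ ℂ w).norm_iteratedFDeriv_comp_left h1 (n := m) le_rfl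
  refine h2.trans ?_
  gcongr
  refine ContinuousLinearMap.opNorm_le_bound _ (norm_nonneg w) fun L => ?_
  rw [mul_comm]
  exact L.le_opNorm w

/-- The derivative of the homogeneous extension in a fixed direction, as a function on
`𝕊^d × ℝ`. -/
def dirDerivFun (w : Euc d × ℝ) : SphereSchwartz d →ₗ[ℂ] (Sph d × ℝ → ℂ) where
  toFun ρ q := fderiv ℝ (homExt ρ) ((q.1 : Euc d), q.2) w
  map_add' ρ σ := by
    funext q
    have h : homExt ((ρ + σ : SphereSchwartz d) : Sph d × ℝ → ℂ) = homExt ρ + homExt σ :=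
      homExt_add _ _
    rw [h, fderiv_add (ρ.differentiableAt (sph_mem_offAxis _ _))
      (σ.differentiableAt (sph_mem_offAxis _ _))]
    rfl
  map_smul' c ρ := by
    funext q
    have h : homExt ((c • ρ : SphereSchwartz d) : Sph d × ℝ → ℂ) = c • homExt ρ :=
      RadonLizorkin.homExt_smul _ _
    rw [h, fderiv_const_smul (ρ.differentiableAt (sph_mem_offAxis _ _))]
    rfl

/-- The degree 0 extension of the values on the sphere differs from the derivative itself: the part
in x has degree -1 and needs the factor `‖y.1‖`, while the part in p needs none. -/
lemma homExt_dirDerivFun (w : Euc d × ℝ) (ρ : SphereSchwartz d) {y : Euc d × ℝ}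
    (hy : y ∈ offAxis d) : homExt (dirDerivFun w ρ) y =
      fderiv ℝ (homExt ρ) y (w.1, 0) • (‖y.1‖ : ℂ) + fderiv ℝ (homExt ρ) y (0, w.2) := by
  obtain ⟨x, p⟩ := y
  have hx : x ≠ 0 := hy
  have hn : 0 < ‖x‖ := norm_pos_iff.2 hx
  rw [homExt_of_ne _ hx]
  change fderiv ℝ (homExt ρ) (‖x‖⁻¹ • x, p) w = _
  have h := ρ.fderiv_homExt_smul_fst (inv_pos.2 hn) hx p (‖x‖ • w.1, w.2)
  simp only [smul_smul, inv_mul_cancel₀ hn.ne', one_smul] at h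
  rw [h]
  have h2 : ((‖x‖ • w.1, w.2) : Euc d × ℝ) = ‖x‖ • (w.1, 0) + (0, w.2) := by simp
  rw [h2, map_add, map_smul]
  simp [mul_comm]

lemma isMultiplier_norm : IsMultiplier fun y : Euc d × ℝ => (‖y.1‖ : ℂ) := by
  refine isMultiplier_comp_fst (b := fun x : Euc d => (‖x‖ : ℂ)) fun x hx => ?_
  exact (Complex.ofRealCLM.contDiff.contDiffAt.comp x (contDiffAt_norm ℝ hx)).contDiffWithinAt

/-- The derivative in a fixed direction. -/
def dirDeriv (w : Euc d × ℝ) : SphereSchwartz d →L[ℂ] SphereSchwartz d :=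
  SphereSchwartz.mkCLM (dirDerivFun w)
    (fun ρ => isSmooth_of_contDiffOn (ρ.contDiffOn_fderiv_apply w))
    (fun k m => by
      -- The norm is a multiplier, so the part in x is estimated by the Leibniz rule and the part in
      -- p directly; each costs one more derivative of `ρ`.
      obtain ⟨l, C, hC, h⟩ := (isMultiplier_norm (d := d)).exists_norm_iteratedFDeriv_smul_le m
      have key : BoundedBySeminorm fun (ρ : SphereSchwartz d) (q : Sph d × ℝ) =>
          (∑ j ∈ Finset.range (m + 1), C * (‖((w.1, 0) : Euc d × ℝ)‖ * weight (k + l) (j + 1) ρ q))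
            + ‖((0, w.2) : Euc d × ℝ)‖ * weight k (m + 1) ρ q :=
        (BoundedBySeminorm.sum _ fun j _ => ((boundedBySeminorm_weight d (k + l) (j + 1)).const_mul
          (norm_nonneg _)).const_mul hC).add
          ((boundedBySeminorm_weight d k (m + 1)).const_mul (norm_nonneg _))
      refine key.of_le fun ρ q => ?_
      obtain ⟨u, p⟩ := q
      have hu := sph_mem_offAxis u p
      have he : homExt (dirDerivFun w ρ) =ᶠ[nhds ((u : Euc d), p)]
          (fun y => fderiv ℝ (homExt ρ) y (w.1, 0) • (‖y.1‖ : ℂ)) +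
            fun y => fderiv ℝ (homExt ρ) y (0, w.2) :=
        Filter.eventuallyEq_of_mem (isOpen_offAxis.mem_nhds hu)
          fun y hy => homExt_dirDerivFun w ρ hy
      have hc {G : Euc d × ℝ → ℂ} (hG : ContDiffOn ℝ ∞ G (offAxis d)) :
          ContDiffAt ℝ m G ((u : Euc d), p) :=
        (hG.contDiffAt (isOpen_offAxis.mem_nhds hu)).of_le (mod_cast le_top)
      have hadd := iteratedFDeriv_add_apply
        (hc ((ρ.contDiffOn_fderiv_apply (w.1, 0)).smul isMultiplier_norm.smooth))
        (hc (ρ.contDiffOn_fderiv_apply (0, w.2)))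
      simp only [weight]
      rw [(he.iteratedFDeriv ℝ m).self_of_nhds]
      refine (mul_le_mul_of_nonneg_left (congrArg norm hadd).le (by positivity)).trans ?_
      refine (mul_le_mul_of_nonneg_left (norm_add_le _ _) (by positivity)).trans ?_
      rw [mul_add]
      refine add_le_add ?_ ?_
      · refine (mul_le_mul_of_nonneg_left (h _ (ρ.contDiffOn_fderiv_apply _) u p)
          (by positivity)).trans ?_
        rw [Finset.mul_sum]
        refine Finset.sum_le_sum fun j _ => ?_
        calc (1 + |p|) ^ k * (C * ((1 + |p|) ^ l * ‖iteratedFDeriv ℝ j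
              (fun y => fderiv ℝ (homExt ρ) y (w.1, 0)) ((u : Euc d), p)‖))
            ≤ (1 + |p|) ^ k * (C * ((1 + |p|) ^ l * (‖((w.1, 0) : Euc d × ℝ)‖ *
              ‖iteratedFDeriv ℝ (j + 1) (homExt ρ) ((u : Euc d), p)‖))) := by
              gcongr
              exact ρ.norm_iteratedFDeriv_fderiv_apply_le _ _ hu
          _ = _ := by ring
      · calc (1 + |p|) ^ k * ‖iteratedFDeriv ℝ m
              (fun y => fderiv ℝ (homExt ρ) y (0, w.2)) ((u : Euc d), p)‖
            ≤ (1 + |p|) ^ k * (‖((0, w.2) : Euc d × ℝ)‖ *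
              ‖iteratedFDeriv ℝ (m + 1) (homExt ρ) ((u : Euc d), p)‖) := by
              gcongr
              exact ρ.norm_iteratedFDeriv_fderiv_apply_le _ _ hu
          _ = _ := by ring)

lemma dirDeriv_apply (w : Euc d × ℝ) (ρ : SphereSchwartz d) (q : Sph d × ℝ) :
    dirDeriv w ρ q = fderiv ℝ (homExt ρ) ((q.1 : Euc d), q.2) w := rfl

/-- The derivative `∂ρ/∂p`. -/
def derivSnd (d : ℕ) : SphereSchwartz d →L[ℂ] SphereSchwartz d := dirDeriv (0, 1)

/-- The component `j` of the gradient of `ρ` along the sphere. -/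
def sphGrad (j : Fin (d + 1)) : SphereSchwartz d →L[ℂ] SphereSchwartz d :=
  dirDeriv (EuclideanSpace.single j 1, 0)

lemma homExt_derivSnd (ρ : SphereSchwartz d) {y : Euc d × ℝ} (hy : y ∈ offAxis d) :
    homExt (derivSnd d ρ) y = fderiv ℝ (homExt ρ) y (0, 1) := by
  have h := homExt_dirDerivFun (0, 1) ρ hy
  have h0 : ((0, 0) : Euc d × ℝ) = 0 := rfl
  simp only [h0, map_zero, zero_smul, zero_add] at h
  exact h

lemma homExt_sphGrad (j : Fin (d + 1)) (ρ : SphereSchwartz d) {y : Euc d × ℝ}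
    (hy : y ∈ offAxis d) : homExt (sphGrad j ρ) y =
      fderiv ℝ (homExt ρ) y (EuclideanSpace.single j 1, 0) * (‖y.1‖ : ℂ) := by
  have h := homExt_dirDerivFun (EuclideanSpace.single j 1, 0) ρ hy
  have h0 : ((0, 0) : Euc d × ℝ) = 0 := rfl
  simp only [h0, map_zero, add_zero] at h
  exact h

/-- The derivative of the homogeneous extension of `ρ`, in terms of the homogeneous extensions of
the derivatives of `ρ`. -/
lemma fderiv_homExt (ρ : SphereSchwartz d) {y : Euc d × ℝ} (hy : y ∈ offAxis d) (w : Euc d × ℝ) :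
    fderiv ℝ (homExt ρ) y w =
      (∑ j, homExt (sphGrad j ρ) y * ((‖y.1‖⁻¹ * w.1 j : ℝ) : ℂ)) +
        homExt (derivSnd d ρ) y * (w.2 : ℂ) := by
  have hn : (‖y.1‖ : ℂ) ≠ 0 := mod_cast norm_ne_zero_iff.2 hy
  have hw : w = (∑ j, w.1 j • ((EuclideanSpace.single j 1, 0) : Euc d × ℝ)) + w.2 • (0, 1) := by
    ext i <;> simp [Prod.fst_sum, Prod.snd_sum, Finset.sum_apply, Pi.single_apply]
  conv_lhs => rw [hw]
  rw [map_add, map_sum, map_smul, homExt_derivSnd ρ hy]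
  congr 1
  · refine Finset.sum_congr rfl fun j _ => ?_
    rw [map_smul, homExt_sphGrad j ρ hy, Complex.real_smul]
    push_cast
    field_simp
  · rw [Complex.real_smul, mul_comm]

end SphereSchwartz

open Filter Topology

/-! ### Integrals in the variable `p` -/

/-- Peetre's inequality 1 + |s| ≤ (1 + |p + s|)(1 + |p|) moves the decay of `b` from p + s to s. Two
of the powers pay for the integrable factor 1/(1 + s²), giving a majorant that is locally uniform in
p. -/
lemma one_add_abs_pow_mul_le {b : ℝ → ℝ} (hb : ∀ p, 0 ≤ b p) {C : ℝ} {k : ℕ}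
    (h : ∀ p, (1 + |p|) ^ (k + 2) * b p ≤ C) (p s : ℝ) :
    (1 + |s|) ^ k * b (p + s) ≤ C * (1 + |p|) ^ (k + 2) * (1 + s ^ 2)⁻¹ := by
  rw [← div_eq_mul_inv, le_div_iff₀ (by positivity)]
  have h1 : 1 + |s| ≤ (1 + |p + s|) * (1 + |p|) := by
    have h2 : |s| ≤ |p + s| + |p| := by
      have := abs_sub (p + s) p
      rwa [add_sub_cancel_left] at this
    nlinarith [abs_nonneg p, abs_nonneg (p + s)]
  have h3 : 1 + s ^ 2 ≤ (1 + |s|) ^ 2 := by nlinarith [sq_abs s, abs_nonneg s]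
  calc (1 + |s|) ^ k * b (p + s) * (1 + s ^ 2)
      ≤ (1 + |s|) ^ k * b (p + s) * (1 + |s|) ^ 2 := by
        gcongr
        exact mul_nonneg (by positivity) (hb _)
    _ = (1 + |s|) ^ (k + 2) * b (p + s) := by ring
    _ ≤ ((1 + |p + s|) * (1 + |p|)) ^ (k + 2) * b (p + s) := by
        gcongr
        exact hb _
    _ = ((1 + |p + s|) ^ (k + 2) * b (p + s)) * (1 + |p|) ^ (k + 2) := by rw [mul_pow]; ring
    _ ≤ C * (1 + |p|) ^ (k + 2) := by gcongr; exact h _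

namespace SphereSchwartz

lemma exists_homExt_le (ρ : SphereSchwartz d) (k : ℕ) : ∃ C : ℝ, 0 ≤ C ∧
    ∀ x : Euc d, ∀ p : ℝ, (1 + |p|) ^ k * ‖homExt ρ (x, p)‖ ≤ C := by
  obtain ⟨C, hC⟩ := sphereSchwartz_bound ρ k
  refine ⟨|C|, abs_nonneg C, fun x p => ?_⟩
  by_cases hx : x = 0
  · simp [homExt, hx]
  · rw [homExt_of_ne _ hx]
    exact (hC _ _).trans (le_abs_self C)

/-- The first-order bound on the unit sphere is carried to other points by homogeneity; the degree
-1 in x accounts for the term `‖x‖⁻¹`. -/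
lemma exists_fderiv_homExt_le (ρ : SphereSchwartz d) (k : ℕ) : ∃ C : ℝ, 0 ≤ C ∧
    ∀ x : Euc d, x ≠ 0 → ∀ p : ℝ,
      (1 + |p|) ^ k * ‖fderiv ℝ (homExt ρ) (x, p)‖ ≤ C * (1 + ‖x‖⁻¹) := by
  obtain ⟨C, hC⟩ := ρ.2.2 k 1
  refine ⟨|C|, abs_nonneg C, fun x hx p => ?_⟩
  have hn : 0 < ‖x‖⁻¹ := inv_pos.2 (norm_pos_iff.2 hx)
  set L := fderiv ℝ (homExt ρ) (‖x‖⁻¹ • x, p)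
  have h1 : (1 + |p|) ^ k * ‖L‖ ≤ |C| := by
    have := hC ⟨(radialProj x hx, p), rfl⟩
    rw [weight, ← norm_iteratedFDeriv_fderiv, norm_iteratedFDeriv_zero] at this
    exact this.trans (le_abs_self C)
  have h2 : ‖fderiv ℝ (homExt ρ) (x, p)‖ ≤ ‖L‖ * (1 + ‖x‖⁻¹) := by
    refine ContinuousLinearMap.opNorm_le_bound _ (by positivity) fun w => ?_
    rw [← ρ.fderiv_homExt_smul_fst hn hx p w, mul_assoc]
    refine (L.le_opNorm _).trans ?_
    gcongr
    rw [Prod.norm_def, norm_smul, Real.norm_of_nonneg hn.le]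
    refine max_le ?_ ?_
    · nlinarith [norm_fst_le w, norm_nonneg w]
    · nlinarith [norm_snd_le w, norm_nonneg w]
  calc (1 + |p|) ^ k * ‖fderiv ℝ (homExt ρ) (x, p)‖
      ≤ (1 + |p|) ^ k * (‖L‖ * (1 + ‖x‖⁻¹)) := by gcongr
    _ = ((1 + |p|) ^ k * ‖L‖) * (1 + ‖x‖⁻¹) := by ring
    _ ≤ _ := by gcongr

lemma continuous_homExt_add (ρ : SphereSchwartz d) {y : Euc d × ℝ} (hy : y ∈ offAxis d) :
    Continuous fun s : ℝ => homExt ρ (y.1, y.2 + s) :=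
  ρ.contDiffOn.continuousOn.comp_continuous (by fun_prop) fun _ => hy

lemma continuous_fderiv_homExt_add (ρ : SphereSchwartz d) {y : Euc d × ℝ} (hy : y ∈ offAxis d) :
    Continuous fun s : ℝ => fderiv ℝ (homExt ρ) (y.1, y.2 + s) :=
  (ρ.contDiffOn.continuousOn_fderiv_of_isOpen isOpen_offAxis (by simp)).comp_continuous
    (by fun_prop) fun _ => hy

section Parametric

variable {g : ℝ → ℂ} {k : ℕ}

lemma integrable_mul_homExt (ρ : SphereSchwartz d) (hg : AEStronglyMeasurable g)
    (hgk : ∀ s, ‖g s‖ ≤ (1 + |s|) ^ k) {y : Euc d × ℝ} (hy : y ∈ offAxis d) :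
    Integrable fun s => g s * homExt ρ (y.1, y.2 + s) := by
  obtain ⟨C, hC, h⟩ := ρ.exists_homExt_le (k + 2)
  refine (integrable_inv_one_add_sq.const_mul (C * (1 + |y.2|) ^ (k + 2))).mono'
    (hg.mul (ρ.continuous_homExt_add hy).aestronglyMeasurable) (.of_forall fun s => ?_)
  rw [norm_mul]
  refine le_trans ?_ (one_add_abs_pow_mul_le (b := fun p => ‖homExt ρ (y.1, p)‖)
    (fun p => norm_nonneg _) (h y.1) y.2 s)
  gcongr
  exact hgk s

lemma integrable_smul_fderiv_homExt (ρ : SphereSchwartz d) (hg : AEStronglyMeasurable g)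
    (hgk : ∀ s, ‖g s‖ ≤ (1 + |s|) ^ k) {y : Euc d × ℝ} (hy : y ∈ offAxis d) :
    Integrable fun s => g s • fderiv ℝ (homExt ρ) (y.1, y.2 + s) := by
  obtain ⟨C, hC, h⟩ := ρ.exists_fderiv_homExt_le (k + 2)
  refine (integrable_inv_one_add_sq.const_mul
    (C * (1 + ‖y.1‖⁻¹) * (1 + |y.2|) ^ (k + 2))).mono'
    (hg.smul (ρ.continuous_fderiv_homExt_add hy).aestronglyMeasurable) (.of_forall fun s => ?_)
  rw [norm_smul]
  refine le_trans ?_ (one_add_abs_pow_mul_le (b := fun p => ‖fderiv ℝ (homExt ρ) (y.1, p)‖)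
    (fun p => norm_nonneg _) (h y.1 hy) y.2 s)
  gcongr
  exact hgk s

/-- Used for two weights: powers of s, which give the moments in p, and the indicator of a
half-line, which gives the primitive in p. -/
lemma hasFDerivAt_integral_mul_homExt (ρ : SphereSchwartz d) (hg : AEStronglyMeasurable g)
    (hgk : ∀ s, ‖g s‖ ≤ (1 + |s|) ^ k) {y : Euc d × ℝ} (hy : y ∈ offAxis d) :
    HasFDerivAt (fun y : Euc d × ℝ => ∫ s, g s * homExt ρ (y.1, y.2 + s))
      (∫ s, g s • fderiv ℝ (homExt ρ) (y.1, y.2 + s)) y := by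
  obtain ⟨C, hC, h⟩ := ρ.exists_fderiv_homExt_le (k + 2)
  have hn : 0 < ‖y.1‖ := norm_pos_iff.2 hy
  -- The majorant blows up as x → 0 and grows in p, so the neighbourhood keeps x away from 0 and p
  -- bounded.
  set S : Set (Euc d × ℝ) := {z | ‖y.1‖ / 2 < ‖z.1‖ ∧ |z.2| < 1 + |y.2|}
  have hSo : IsOpen S :=
    (isOpen_lt (f := fun _ => ‖y.1‖ / 2) continuous_const continuous_fst.norm).inter
      (isOpen_lt (g := fun _ => 1 + |y.2|) continuous_snd.abs continuous_const)
  have hS : S ∈ 𝓝 y := by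
    refine hSo.mem_nhds ⟨?_, ?_⟩
    · show ‖y.1‖ / 2 < ‖y.1‖
      linarith
    · show |y.2| < 1 + |y.2|
      linarith
  have hSU : ∀ z ∈ S, z ∈ offAxis d := by
    rintro z ⟨hz, -⟩
    exact norm_pos_iff.1 (by linarith)
  refine hasFDerivAt_integral_of_dominated_of_fderiv_le (s := S)
    (bound := fun s => C * (1 + (‖y.1‖ / 2)⁻¹) * (1 + (1 + |y.2|)) ^ (k + 2) * (1 + s ^ 2)⁻¹)
    (F' := fun z s => g s • fderiv ℝ (homExt ρ) (z.1, z.2 + s)) hS ?_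
    (ρ.integrable_mul_homExt hg hgk hy) (ρ.integrable_smul_fderiv_homExt hg hgk hy).1
    (.of_forall fun s z hz => ?_) (integrable_inv_one_add_sq.const_mul _)
    (.of_forall fun s z hz => ?_)
  · filter_upwards [isOpen_offAxis.mem_nhds hy] with z hz
    exact hg.mul (ρ.continuous_homExt_add hz).aestronglyMeasurable
  · rw [norm_smul]
    have h1 := one_add_abs_pow_mul_le (b := fun p => ‖fderiv ℝ (homExt ρ) (z.1, p)‖)
      (fun p => norm_nonneg _) (h z.1 (hSU z hz)) z.2 s
    have h2 : ‖z.1‖⁻¹ ≤ (‖y.1‖ / 2)⁻¹ := inv_anti₀ (by positivity) hz.1.le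
    calc ‖g s‖ * ‖fderiv ℝ (homExt ρ) (z.1, z.2 + s)‖
        ≤ (1 + |s|) ^ k * ‖fderiv ℝ (homExt ρ) (z.1, z.2 + s)‖ := by gcongr; exact hgk s
      _ ≤ _ := h1
      _ ≤ _ := by
        gcongr
        exact hz.2.le
  · have h1 : HasFDerivAt (homExt ρ) (fderiv ℝ (homExt ρ) (z.1, z.2 + s)) (z + (0, s)) := by
      have : z + (0, s) = (z.1, z.2 + s) := by simp [Prod.ext_iff]
      rw [this]
      exact (ρ.differentiableAt (y := (z.1, z.2 + s)) (hSU z hz)).hasFDerivAt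
    have h2 := (h1.comp z ((hasFDerivAt_id z).add_const (0, s))).const_mul (g s)
    refine h2.congr_of_eventuallyEq (.of_forall fun w => ?_)
    have : w + (0, s) = (w.1, w.2 + s) := by simp [Prod.ext_iff]
    simp [this]

lemma integral_smul_fderiv_homExt_apply (ρ : SphereSchwartz d) (hg : AEStronglyMeasurable g)
    (hgk : ∀ s, ‖g s‖ ≤ (1 + |s|) ^ k) {y : Euc d × ℝ} (hy : y ∈ offAxis d) (w : Euc d × ℝ) :
    (∫ s, g s • fderiv ℝ (homExt ρ) (y.1, y.2 + s)) w =
      ∫ s, g s * fderiv ℝ (homExt ρ) (y.1, y.2 + s) w := by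
  exact ContinuousLinearMap.integral_apply (ρ.integrable_smul_fderiv_homExt hg hgk hy) w

end Parametric

/-! ### Operators on the Lizorkin space of `𝕊^d × ℝ` -/

lemma hasDerivAt_snd (ρ : SphereSchwartz d) (u : Sph d) (p : ℝ) :
    HasDerivAt (fun p => ρ (u, p)) (derivSnd d ρ (u, p)) p := by
  have h1 := (ρ.differentiableAt (sph_mem_offAxis u p)).hasFDerivAt.comp_hasDerivAt p
    ((hasDerivAt_const p (u : Euc d)).prodMk (hasDerivAt_id p))
  refine h1.congr_of_eventuallyEq (.of_forall fun s => ?_)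
  simp [homExt_sph]

/-- The total derivative of p^k ρ integrates to zero. For k = 0 the truncated exponent is harmless,
since its coefficient vanishes. The identity shows that ∂_p preserves vanishing moments and, read
backwards, that the primitive inherits them. -/
lemma integral_pow_mul_derivSnd (ρ : SphereSchwartz d) (u : Sph d) (k : ℕ) :
    ∫ p : ℝ, (p : ℂ) ^ k * derivSnd d ρ (u, p) =
      - (k * ∫ p : ℝ, (p : ℂ) ^ (k - 1) * ρ (u, p)) := by
  have h1 (p : ℝ) : HasDerivAt (fun p : ℝ => (p : ℂ) ^ k * ρ (u, p))
      (k * ((p : ℂ) ^ (k - 1) * ρ (u, p)) + (p : ℂ) ^ k * derivSnd d ρ (u, p)) p := by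
    have h2 : HasDerivAt (fun p : ℝ => (p : ℂ) ^ k) (k * (p : ℂ) ^ (k - 1)) p :=
      (hasDerivAt_pow k (p : ℂ)).comp_ofReal
    have := h2.mul (ρ.hasDerivAt_snd u p)
    rwa [mul_assoc] at this
  have hi1 := (integrable_sphere_moment ρ u (k - 1)).const_mul (k : ℂ)
  have hi2 := integrable_sphere_moment (derivSnd d ρ) u k
  have h := integral_eq_zero_of_hasDerivAt_of_integrable h1 (hi1.add hi2)
    (integrable_sphere_moment ρ u k)
  rw [integral_add hi1 hi2, integral_const_mul] at h
  linear_combination h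

end SphereSchwartz

namespace SphereLizorkin

open SphereSchwartz

lemma moment_eq_zero (ρ : sphereLizorkin d) (u : Sph d) (k : ℕ) :
    ∫ p : ℝ, (p : ℂ) ^ k * (ρ : SphereSchwartz d) (u, p) = 0 := ρ.2 u k

/-- Multiplication by the coordinate `u_j`. -/
def mulCoord (j : Fin (d + 1)) : sphereLizorkin d →L[ℂ] sphereLizorkin d :=
  (SphereSchwartz.mulCoord j).restrict fun ρ hρ u k => by
    simp only [mulCoord_apply, mul_left_comm _ (((u : Euc d) j : ℝ) : ℂ)]
    rw [integral_const_mul, hρ u k, mul_zero]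

/-- Multiplication by `p`. -/
def mulSnd (d : ℕ) : sphereLizorkin d →L[ℂ] sphereLizorkin d :=
  (SphereSchwartz.mulSnd d).restrict fun ρ hρ u k => by
    simp only [mulSnd_apply, ← mul_assoc, ← pow_succ]
    exact hρ u (k + 1)

/-- The derivative `∂ρ/∂p`. -/
def derivSnd (d : ℕ) : sphereLizorkin d →L[ℂ] sphereLizorkin d :=
  (SphereSchwartz.derivSnd d).restrict fun ρ hρ u k => by
    rw [integral_pow_mul_derivSnd, hρ u (k - 1), mul_zero, neg_zero]

lemma norm_ofReal_pow_le (k : ℕ) (s : ℝ) : ‖(s : ℂ) ^ k‖ ≤ (1 + |s|) ^ k := by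
  rw [norm_pow, Complex.norm_real, Real.norm_eq_abs]
  gcongr
  linarith

lemma aestronglyMeasurable_ofReal_pow (k : ℕ) :
    AEStronglyMeasurable (fun s : ℝ => (s : ℂ) ^ k) := by
  have : Continuous fun s : ℝ => (s : ℂ) ^ k := by fun_prop
  exact this.aestronglyMeasurable

/-- The k-th moment of the extension vanishes for every x ≠ 0, hence so does its derivative in x,
which may be taken under the integral. -/
lemma integral_pow_mul_sphGrad {ρ : SphereSchwartz d} (hρ : ρ ∈ sphereLizorkin d)
    (j : Fin (d + 1)) (u : Sph d) (k : ℕ) :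
    ∫ p : ℝ, (p : ℂ) ^ k * SphereSchwartz.sphGrad j ρ (u, p) = 0 := by
  have hu := sph_mem_offAxis u 0
  have hm := aestronglyMeasurable_ofReal_pow k
  have hk := norm_ofReal_pow_le k
  have h1 := ρ.hasFDerivAt_integral_mul_homExt hm hk hu
  -- The line leaves the sphere, but near t = 0 it avoids the origin, where the extension is a value
  -- of `ρ` at a projected point. With p = 0 the parametric integral is exactly the k-th moment.
  have h2 : HasDerivAt (fun t : ℝ => ((u : Euc d) + t • EuclideanSpace.single j (1 : ℝ), (0 : ℝ)))
      (EuclideanSpace.single j 1, 0) 0 := by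
    refine HasDerivAt.prodMk ?_ (hasDerivAt_const _ _)
    simpa using ((hasDerivAt_id (0 : ℝ)).smul_const (EuclideanSpace.single j (1 : ℝ))).const_add
      (u : Euc d)
  have h3 := HasFDerivAt.comp_hasDerivAt_of_eq (0 : ℝ) h1 h2 (by simp)
  rw [ρ.integral_smul_fderiv_homExt_apply hm hk hu] at h3
  have h4 : (fun y : Euc d × ℝ => ∫ s : ℝ, (s : ℂ) ^ k * homExt ρ (y.1, y.2 + s)) ∘
      (fun t : ℝ => ((u : Euc d) + t • EuclideanSpace.single j (1 : ℝ), (0 : ℝ))) =ᶠ[𝓝 0]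
      fun _ => 0 := by
    have hc : ContinuousAt (fun t : ℝ => (u : Euc d) + t • EuclideanSpace.single j (1 : ℝ)) 0 := by
      fun_prop
    have hne := hc.eventually_ne (y := 0) (by simpa using sph_ne_zero u)
    filter_upwards [hne] with t ht
    simp only [Function.comp_apply, zero_add]
    simp only [homExt_of_ne _ ht]
    exact hρ _ k
  have h5 := h3.unique ((hasDerivAt_const (0 : ℝ) (0 : ℂ)).congr_of_eventuallyEq h4)
  simpa [SphereSchwartz.sphGrad, dirDeriv_apply] using h5

/-- The component `j` of the gradient of `ρ` along the sphere. -/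
def sphGrad (j : Fin (d + 1)) : sphereLizorkin d →L[ℂ] sphereLizorkin d :=
  (SphereSchwartz.sphGrad j).restrict fun _ hρ => integral_pow_mul_sphGrad hρ j

lemma mulCoord_apply (j : Fin (d + 1)) (ρ : sphereLizorkin d) (q : Sph d × ℝ) :
    (mulCoord j ρ : SphereSchwartz d) q =
      (((q.1 : Euc d) j : ℝ) : ℂ) * (ρ : SphereSchwartz d) q := rfl

lemma mulSnd_apply (ρ : sphereLizorkin d) (q : Sph d × ℝ) :
    (mulSnd d ρ : SphereSchwartz d) q = (q.2 : ℂ) * (ρ : SphereSchwartz d) q := rfl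

lemma coe_sphGrad (j : Fin (d + 1)) (ρ : sphereLizorkin d) :
    (sphGrad j ρ : SphereSchwartz d) = SphereSchwartz.sphGrad j ρ := rfl

/-! ### The primitive in `p` -/

/-- The indicator function of the negative half-line. -/
def negIndicator (s : ℝ) : ℂ := (Set.Iic (0 : ℝ)).indicator 1 s

lemma aestronglyMeasurable_negIndicator : AEStronglyMeasurable negIndicator :=
  (stronglyMeasurable_one.indicator measurableSet_Iic).aestronglyMeasurable

lemma norm_negIndicator_le (s : ℝ) : ‖negIndicator s‖ ≤ (1 + |s|) ^ 0 := by
  rw [pow_zero, negIndicator]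
  refine (norm_indicator_le_norm_self _ _).trans ?_
  simp

lemma negIndicator_mul (f : ℝ → ℂ) :
    (fun s => negIndicator s * f s) = (Set.Iic (0 : ℝ)).indicator f := by
  funext s
  by_cases h : s ∈ Set.Iic (0 : ℝ) <;> simp [negIndicator, h]

lemma homExt_integral (g : ℝ → ℂ) (ρ : SphereSchwartz d) {y : Euc d × ℝ} (hy : y ∈ offAxis d) :
    homExt (fun q => ∫ s, g s * ρ (q.1, q.2 + s)) y =
      ∫ s, g s * homExt ρ (y.1, y.2 + s) := by
  obtain ⟨x, p⟩ := y
  have hx : x ≠ 0 := hy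
  rw [homExt_of_ne _ hx]
  simp only [homExt_of_ne _ hx]

lemma integrable_mul_apply_add {g : ℝ → ℂ} {k : ℕ} (ρ : SphereSchwartz d)
    (hg : AEStronglyMeasurable g) (hgk : ∀ s, ‖g s‖ ≤ (1 + |s|) ^ k) (u : Sph d) (p : ℝ) :
    Integrable fun s => g s * ρ (u, p + s) := by
  have := ρ.integrable_mul_homExt hg hgk (sph_mem_offAxis u p)
  simpa only [homExt_sph] using this

lemma integrable_apply_add (ρ : SphereSchwartz d) (u : Sph d) (p : ℝ) :
    Integrable fun s => ρ (u, p + s) := by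
  simpa using integrable_mul_apply_add (g := fun _ => 1) (k := 0) ρ
    aestronglyMeasurable_const (by simp) u p

/-- The function `∫_{-∞}^p ρ(u, s) ds`. -/
def primitiveFun (d : ℕ) : sphereLizorkin d →ₗ[ℂ] (Sph d × ℝ → ℂ) where
  -- Translating the variable fixes the domain of integration and puts p into the integrand, so
  -- `hasFDerivAt_integral_mul_homExt` applies.
  toFun ρ q := ∫ s, negIndicator s * (ρ : SphereSchwartz d) (q.1, q.2 + s)
  map_add' ρ σ := by
    funext q
    have hi (τ : sphereLizorkin d) := integrable_mul_apply_add (τ : SphereSchwartz d)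
      aestronglyMeasurable_negIndicator norm_negIndicator_le q.1 q.2
    rw [Pi.add_apply, ← integral_add (hi ρ) (hi σ)]
    refine integral_congr_ae (.of_forall fun s => ?_)
    simp [SphereSchwartz.add_apply, mul_add]
  map_smul' c ρ := by
    funext q
    rw [RingHom.id_apply, Pi.smul_apply, smul_eq_mul, ← integral_const_mul]
    refine integral_congr_ae (.of_forall fun s => ?_)
    simp [SphereSchwartz.smul_apply, mul_left_comm]

lemma primitiveFun_apply (ρ : sphereLizorkin d) (q : Sph d × ℝ) :
    primitiveFun d ρ q = ∫ s, negIndicator s * (ρ : SphereSchwartz d) (q.1, q.2 + s) := rfl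

lemma primitiveFun_eq_setIntegral_Iic (ρ : sphereLizorkin d) (u : Sph d) (p : ℝ) :
    primitiveFun d ρ (u, p) = ∫ s in Set.Iic 0, (ρ : SphereSchwartz d) (u, p + s) := by
  rw [primitiveFun_apply, negIndicator_mul, integral_indicator measurableSet_Iic]

/-- The moment of order 0 vanishes. This form yields decay as p → +∞, where the integral over the
left half-line would show none. -/
lemma primitiveFun_eq_neg_setIntegral_Ioi (ρ : sphereLizorkin d) (u : Sph d) (p : ℝ) :
    primitiveFun d ρ (u, p) = -∫ s in Set.Ioi 0, (ρ : SphereSchwartz d) (u, p + s) := by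
  have hi := integrable_apply_add (ρ : SphereSchwartz d) u p
  have h := integral_add_compl (s := Set.Iic (0 : ℝ)) measurableSet_Iic hi
  have h0 : ∫ s, (ρ : SphereSchwartz d) (u, p + s) = 0 := by
    rw [integral_add_left_eq_self (fun s => (ρ : SphereSchwartz d) (u, s)) p]
    simpa using moment_eq_zero ρ u 0
  rw [h0, Set.compl_Iic] at h
  rw [primitiveFun_eq_setIntegral_Iic]
  linear_combination h

/-- When |p + s| = |p| + |s|, the weight at p + s dominates both the weight at p and, with two more
powers, 1 + s². The constant π is the integral of 1/(1 + s²). -/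
lemma norm_setIntegral_apply_add_le {ρ : SphereSchwartz d} {k : ℕ} {C : ℝ} {u : Sph d}
    (hC : ∀ p, (1 + |p|) ^ (k + 2) * ‖ρ (u, p)‖ ≤ C) {A : Set ℝ} (hA : MeasurableSet A) {p : ℝ}
    (hp : ∀ s ∈ A, |p + s| = |p| + |s|) :
    (1 + |p|) ^ k * ‖∫ s in A, ρ (u, p + s)‖ ≤ Real.pi * C := by
  have h1 : ∀ s ∈ A, ‖(1 + |p| : ℝ) ^ k • ρ (u, p + s)‖ ≤ C * (1 + s ^ 2)⁻¹ := by
    intro s hs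
    rw [← div_eq_mul_inv, le_div_iff₀ (by positivity), norm_smul, norm_pow,
      Real.norm_of_nonneg (by positivity)]
    refine le_trans ?_ (hC (p + s))
    rw [hp s hs]
    have h2 : 1 + s ^ 2 ≤ (1 + (|p| + |s|)) ^ 2 := by
      nlinarith [sq_abs s, abs_nonneg s, abs_nonneg p, mul_nonneg (abs_nonneg p) (abs_nonneg s),
        sq_nonneg |p|]
    calc (1 + |p|) ^ k * ‖ρ (u, p + s)‖ * (1 + s ^ 2)
        ≤ (1 + (|p| + |s|)) ^ k * ‖ρ (u, p + s)‖ * (1 + (|p| + |s|)) ^ 2 := by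
          gcongr
          linarith [abs_nonneg s]
      _ = _ := by ring
  have hC0 : 0 ≤ C := le_trans (by positivity) (hC 0)
  have hint : Integrable fun s : ℝ => C * (1 + s ^ 2)⁻¹ := integrable_inv_one_add_sq.const_mul C
  calc (1 + |p|) ^ k * ‖∫ s in A, ρ (u, p + s)‖
      = ‖∫ s in A, (1 + |p| : ℝ) ^ k • ρ (u, p + s)‖ := by
        rw [integral_smul, norm_smul, norm_pow, Real.norm_of_nonneg (by positivity)]
    _ ≤ ∫ s in A, C * (1 + s ^ 2)⁻¹ :=
        norm_integral_le_of_norm_le hint.integrableOn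
          ((ae_restrict_iff' hA).2 (.of_forall h1))
    _ ≤ ∫ s, C * (1 + s ^ 2)⁻¹ :=
        setIntegral_le_integral hint (.of_forall fun s => by positivity)
    _ = Real.pi * C := by
        rw [integral_const_mul, integral_univ_inv_one_add_sq, mul_comm]

lemma norm_primitiveFun_le (ρ : sphereLizorkin d) {k : ℕ} {C : ℝ} {u : Sph d}
    (hC : ∀ p, (1 + |p|) ^ (k + 2) * ‖(ρ : SphereSchwartz d) (u, p)‖ ≤ C) (p : ℝ) :
    (1 + |p|) ^ k * ‖primitiveFun d ρ (u, p)‖ ≤ Real.pi * C := by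
  -- Integrate away from the origin, over the half-line on which s has the sign of p.
  rcases le_total p 0 with hp | hp
  · rw [primitiveFun_eq_setIntegral_Iic]
    refine norm_setIntegral_apply_add_le hC measurableSet_Iic fun s hs => ?_
    have hs' : s ≤ 0 := hs
    rw [abs_of_nonpos hp, abs_of_nonpos hs', abs_of_nonpos (by linarith)]
    ring
  · rw [primitiveFun_eq_neg_setIntegral_Ioi, norm_neg]
    refine norm_setIntegral_apply_add_le hC measurableSet_Ioi fun s hs => ?_
    have hs' : 0 < s := hs
    rw [abs_of_nonneg hp, abs_of_nonneg hs'.le, abs_of_nonneg (by linarith)]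

/-- The coefficients of `dx_j` and `dp` in the derivative of a homogeneous extension. -/
def derivCoeff : Option (Fin (d + 1)) → Euc d × ℝ → (Euc d × ℝ →L[ℝ] ℂ)
  | none => fun _ => Complex.ofRealCLM ∘L ContinuousLinearMap.snd ℝ (Euc d) ℝ
  | some j => fun y => ‖y.1‖⁻¹ • (Complex.ofRealCLM ∘L
      (EuclideanSpace.proj j : Euc d →L[ℝ] ℝ) ∘L ContinuousLinearMap.fst ℝ (Euc d) ℝ)

lemma sum_smul_derivCoeff_apply (c : Option (Fin (d + 1)) → ℂ) (y w : Euc d × ℝ) :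
    (∑ i, c i • derivCoeff i y) w =
      (∑ j, c (some j) * ((‖y.1‖⁻¹ * w.1 j : ℝ) : ℂ)) + c none * (w.2 : ℂ) := by
  rw [_root_.sum_apply, Fintype.sum_option, add_comm]
  congr 1
  refine Finset.sum_congr rfl fun j _ => ?_
  rw [_root_.smul_apply, smul_eq_mul]
  congr 1
  simp [derivCoeff]

lemma isMultiplier_derivCoeff (i : Option (Fin (d + 1))) :
    IsMultiplier (derivCoeff (d := d) i) := by
  cases i with
  | none => exact isMultiplier_comp_fst (d := d) (b := fun _ => _) contDiffOn_const
  | some j =>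
    refine isMultiplier_comp_fst (d := d) (b := fun x => ‖x‖⁻¹ • _) fun x hx => ?_
    exact (((contDiffAt_norm ℝ hx).inv (norm_ne_zero_iff.2 hx)).smul
      contDiffAt_const).contDiffWithinAt

lemma hasFDerivAt_primitiveFun (ρ : sphereLizorkin d) {y : Euc d × ℝ} (hy : y ∈ offAxis d) :
    HasFDerivAt (homExt (primitiveFun d ρ))
      (∫ s, negIndicator s • fderiv ℝ (homExt (ρ : SphereSchwartz d)) (y.1, y.2 + s)) y := by
  refine ((ρ : SphereSchwartz d).hasFDerivAt_integral_mul_homExt aestronglyMeasurable_negIndicator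
    norm_negIndicator_le hy).congr_of_eventuallyEq ?_
  filter_upwards [isOpen_offAxis.mem_nhds hy] with z hz
  exact homExt_integral negIndicator (ρ : SphereSchwartz d) hz

/-- The primitive `∫_{-∞}^p ρ(u, s) ds`, as an element of `𝓢(𝕊^d × ℝ)`. -/
def primitiveSchwartz (d : ℕ) : sphereLizorkin d →L[ℂ] SphereSchwartz d :=
  SphereSchwartz.mkCLMOfDeriv (ι := Option (Fin (d + 1))) (primitiveFun d)
    -- Differentiation commutes with the integral over translates in p: the derivatives of the
    -- primitive are primitives of derivatives of `ρ`. These derivatives stay in the Lizorkin space,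
    -- so the family is closed.
    (fun i => i.elim (derivSnd d) sphGrad) isMultiplier_derivCoeff
    (fun ρ y hy => by
      convert! hasFDerivAt_primitiveFun ρ hy using 1
      refine ContinuousLinearMap.ext fun w => ?_
      have hi (σ : SphereSchwartz d) := σ.integrable_mul_homExt aestronglyMeasurable_negIndicator
        norm_negIndicator_le hy
      rw [integral_smul_fderiv_homExt_apply (ρ : SphereSchwartz d)
        aestronglyMeasurable_negIndicator norm_negIndicator_le hy]
      have h1 (s : ℝ) : negIndicator s *
          fderiv ℝ (homExt (ρ : SphereSchwartz d)) (y.1, y.2 + s) w =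
          (∑ j, negIndicator s * homExt (SphereSchwartz.sphGrad j (ρ : SphereSchwartz d))
            (y.1, y.2 + s) * ((‖y.1‖⁻¹ * w.1 j : ℝ) : ℂ)) +
          negIndicator s * homExt (SphereSchwartz.derivSnd d (ρ : SphereSchwartz d))
            (y.1, y.2 + s) * (w.2 : ℂ) := by
        have h2 := SphereSchwartz.fderiv_homExt (ρ : SphereSchwartz d) (y := (y.1, y.2 + s)) hy w
        refine (congrArg (negIndicator s * ·) h2).trans ?_
        simp only [mul_add, Finset.mul_sum, mul_assoc]
      simp only [h1]
      rw [integral_add (integrable_finsetSum _ fun j _ => (hi _).mul_const _)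
        ((hi _).mul_const _), integral_finsetSum _ fun j _ => (hi _).mul_const _]
      simp only [integral_mul_const, ← homExt_integral negIndicator _ hy]
      exact sum_smul_derivCoeff_apply _ y w)
    (fun k => by
      obtain ⟨q, hqc, hq⟩ :=
        (boundedBySeminorm_apply d (k + 2)).comp (sphereLizorkin d).subtypeL
      have hb : BoundedBySeminorm fun ρ (_ : Sph d × ℝ) => q ρ := ⟨q, hqc, fun _ _ => le_rfl⟩
      exact (hb.const_mul Real.pi_nonneg).of_le fun ρ x =>
        norm_primitiveFun_le ρ (fun p => hq ρ (x.1, p)) x.2)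

/-- Under the integral ∂_p falls on `ρ`, and the fundamental theorem of calculus on (-∞, 0] leaves
only the boundary value at 0. -/
lemma derivSnd_primitiveSchwartz (ρ : sphereLizorkin d) :
    SphereSchwartz.derivSnd d (primitiveSchwartz d ρ) = ρ := by
  refine Subtype.ext (funext fun q => ?_)
  obtain ⟨u, p⟩ := q
  have hu := sph_mem_offAxis u p
  have h1 : SphereSchwartz.derivSnd d (primitiveSchwartz d ρ) (u, p) =
      fderiv ℝ (homExt (primitiveFun d ρ)) ((u : Euc d), p) (0, 1) := rfl
  refine h1.trans ?_
  rw [(hasFDerivAt_primitiveFun ρ hu).fderiv, integral_smul_fderiv_homExt_apply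
    (ρ : SphereSchwartz d) aestronglyMeasurable_negIndicator norm_negIndicator_le hu,
    negIndicator_mul, integral_indicator measurableSet_Iic]
  have h2 (s : ℝ) : HasDerivAt (fun s => (ρ : SphereSchwartz d) (u, p + s))
      (SphereSchwartz.derivSnd d (ρ : SphereSchwartz d) (u, p + s)) s :=
    ((ρ : SphereSchwartz d).hasDerivAt_snd u (p + s)).comp_const_add p s
  have hi1 := (integrable_apply_add (ρ : SphereSchwartz d) u p).integrableOn (s := Set.Iic 0)
  have hi2 := (integrable_apply_add (SphereSchwartz.derivSnd d (ρ : SphereSchwartz d)) u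
    p).integrableOn (s := Set.Iic 0)
  have h3 := integral_Iic_of_hasDerivAt_of_tendsto' (a := (0 : ℝ)) (fun s _ => h2 s) hi2
    (tendsto_zero_of_hasDerivAt_of_integrableOn_Iic (a := (0 : ℝ)) (fun s _ => h2 s) hi2 hi1)
  rw [sub_zero, add_zero] at h3
  exact h3

/-- The primitive `∫_{-∞}^p ρ(u, s) ds`. -/
def primitive (d : ℕ) : sphereLizorkin d →L[ℂ] sphereLizorkin d :=
  (primitiveSchwartz d).codRestrict (sphereLizorkin d) fun ρ u k => by
    -- The moment of order k + 1 of `ρ` is -(k + 1) times the moment of order k of its primitive.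
    have h := integral_pow_mul_derivSnd (primitiveSchwartz d ρ) u (k + 1)
    rw [derivSnd_primitiveSchwartz, moment_eq_zero, Nat.add_sub_cancel] at h
    have hk : ((k + 1 : ℕ) : ℂ) ≠ 0 := Nat.cast_ne_zero.2 k.succ_ne_zero
    exact (mul_eq_zero.1 (neg_eq_zero.1 h.symm)).resolve_left hk

end SphereLizorkin

/-! ### Integration by parts on the sphere -/

/-- The surface measure of the unit sphere. -/
abbrev sphMeasure (d : ℕ) : Measure (Sph d) := (volume : Measure (Euc d)).toSphere

/-- Polar coordinates for a function that is a product of a radial and an angular part. -/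
lemma integral_eq_mul_of_polar {h : Euc d → ℂ} {c : ℝ → ℂ} {a : Sph d → ℂ}
    (hh : ∀ (u : Sph d) (r : ℝ), 0 < r → h (r • (u : Euc d)) = a u * c r) :
    ∫ x, h x = (∫ u, a u ∂sphMeasure d) * ∫ r in Set.Ioi (0 : ℝ), (r : ℂ) ^ d * c r := by
  have hdim : Module.finrank ℝ (Euc d) - 1 = d := by simp
  calc ∫ x, h x =
      ∫ x : ({(0 : Euc d)}ᶜ : Set (Euc d)), h x ∂((volume : Measure (Euc d)).comap (↑)) := by
        rw [integral_subtype_comap (measurableSet_singleton _).compl h, restrict_compl_singleton]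
    _ = ∫ z : Sph d × Set.Ioi (0 : ℝ), a z.1 * c z.2
          ∂((sphMeasure d).prod (Measure.volumeIoiPow d)) := by
        have hmp := (volume : Measure (Euc d)).measurePreserving_homeomorphUnitSphereProd
        rw [hdim] at hmp
        rw [← hmp.integral_comp (Homeomorph.measurableEmbedding _)]
        refine integral_congr_ae (.of_forall fun x => ?_)
        have := hh (homeomorphUnitSphereProd (Euc d) x).1 (homeomorphUnitSphereProd (Euc d) x).2
          (homeomorphUnitSphereProd (Euc d) x).2.2
        refine Eq.trans ?_ this
        rw [← homeomorphUnitSphereProd_symm_apply_coe, Homeomorph.symm_apply_apply]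
    _ = (∫ u, a u ∂sphMeasure d) * ∫ r : Set.Ioi (0 : ℝ), c r ∂(Measure.volumeIoiPow d) :=
        integral_prod_mul a fun r : Set.Ioi (0 : ℝ) => c r
    _ = _ := by
      congr 1
      simp only [Measure.volumeIoiPow, ENNReal.ofReal]
      rw [integral_withDensity_eq_integral_smul
        (measurable_subtype_coe.pow_const _).real_toNNReal,
        integral_subtype_comap measurableSet_Ioi fun r => Real.toNNReal (r ^ d) • c r]
      refine setIntegral_congr_fun measurableSet_Ioi fun r hr => ?_
      rw [NNReal.smul_def, Real.coe_toNNReal _ (pow_nonneg (Set.mem_Ioi.1 hr).le _),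
        Complex.real_smul, Complex.ofReal_pow]

lemma integrable_of_support_subset_annulus {h : Euc d → ℂ} (hc : ContinuousOn h {0}ᶜ)
    (hs : ∀ x, h x ≠ 0 → 1 ≤ ‖x‖ ∧ ‖x‖ ≤ 3) : Integrable h := by
  have hK : IsCompact {x : Euc d | 1 ≤ ‖x‖ ∧ ‖x‖ ≤ 3} := by
    refine (isCompact_closedBall (0 : Euc d) 3).of_isClosed_subset ?_ fun x hx => ?_
    · exact (isClosed_le continuous_const continuous_norm).inter
        (isClosed_le continuous_norm continuous_const)
    · simpa using hx.2
  have h1 : IntegrableOn h {x : Euc d | 1 ≤ ‖x‖ ∧ ‖x‖ ≤ 3} := by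
    refine (hc.mono fun x hx => ?_).integrableOn_compact hK
    rintro (rfl : x = 0)
    norm_num at hx
  exact (integrableOn_iff_integrable_of_support_subset fun x hx => hs x hx).1 h1

/-- A smooth bump function with support in `(1, 3)`. -/
def radialBump : ContDiffBump (2 : ℝ) := ⟨1 / 2, 1, by norm_num, by norm_num⟩

lemma radialBump_ne_zero {r : ℝ} (h : radialBump r ≠ 0) : 1 < r ∧ r < 3 := by
  have h1 : r ∈ ball (2 : ℝ) 1 := by
    have := radialBump.support_eq (E := ℝ)
    rw [← show radialBump.rOut = 1 from rfl, ← this]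
    exact h
  rw [mem_ball, Real.dist_eq, abs_lt] at h1
  constructor <;> linarith [h1.1, h1.2]

lemma deriv_radialBump_ne_zero {r : ℝ} (h : deriv radialBump r ≠ 0) : 1 ≤ r ∧ r ≤ 3 := by
  have h1 : r ∈ tsupport radialBump := support_deriv_subset h
  rw [radialBump.tsupport_eq, mem_closedBall, Real.dist_eq,
    show radialBump.rOut = 1 from rfl, abs_le] at h1
  constructor <;> linarith [h1.1, h1.2]

lemma hasDerivAt_radialBump (r : ℝ) : HasDerivAt radialBump (deriv radialBump r) r :=
  (radialBump.contDiff.differentiable (n := 1) (by simp) r).hasDerivAt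

lemma continuous_deriv_radialBump : Continuous (deriv radialBump) :=
  radialBump.contDiff.continuous_deriv (n := 1) le_rfl

lemma integral_pow_mul_radialBump_pos (d : ℕ) : 0 < ∫ r : ℝ in Set.Ioi 0, r ^ d * radialBump r := by
  rw [setIntegral_eq_integral_of_forall_compl_eq_zero fun r hr => by
    by_contra h
    exact hr (by simpa using (zero_lt_one.trans (radialBump_ne_zero (right_ne_zero_of_mul h)).1))]
  have hc : Continuous fun r : ℝ => r ^ d * radialBump r :=
    (continuous_pow d).mul radialBump.continuous
  refine hc.integral_pos_of_hasCompactSupport_nonneg_nonzero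
    (radialBump.hasCompactSupport.mul_left) (fun r => ?_) (x := 2) ?_
  · by_cases h : radialBump r = 0
    · simp [h]
    · have := (radialBump_ne_zero h).1
      have := radialBump.nonneg (x := r)
      simp only [Pi.zero_apply]
      positivity
  · have : radialBump 2 = 1 := radialBump.one_of_mem_closedBall (by simp [radialBump])
    simp [this]

/-- With χ the bump function, the integrand is (r^(d+1) χ)' - d r^d χ. This is the source of the
factor `d` in the integration by parts on the sphere. -/
lemma integral_pow_mul_deriv_radialBump (d : ℕ) :
    ∫ r : ℝ in Set.Ioi 0, r ^ d * (radialBump r + r * deriv radialBump r) =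
      -(d * ∫ r : ℝ in Set.Ioi 0, r ^ d * radialBump r) := by
  have hpos {r : ℝ} (hr : r ∉ Set.Ioi (0 : ℝ)) : radialBump r = 0 ∧ deriv radialBump r = 0 := by
    constructor <;> by_contra h
    · exact hr (zero_lt_one.trans (radialBump_ne_zero h).1)
    · exact hr (zero_lt_one.trans_le (deriv_radialBump_ne_zero h).1)
  rw [setIntegral_eq_integral_of_forall_compl_eq_zero fun r hr => by simp [hpos hr],
    setIntegral_eq_integral_of_forall_compl_eq_zero fun r hr => by simp [hpos hr]]
  have hb := radialBump.continuous
  have hcs := radialBump.hasCompactSupport (E := ℝ)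
  have h1 : Integrable fun r : ℝ => r ^ d * radialBump r :=
    ((continuous_pow d).mul hb).integrable_of_hasCompactSupport hcs.mul_left
  have h2 : Integrable fun r : ℝ => r ^ d * (radialBump r + r * deriv radialBump r) :=
    ((continuous_pow d).mul (hb.add (continuous_id.mul
      continuous_deriv_radialBump))).integrable_of_hasCompactSupport
      (hcs.add (hcs.deriv.mul_left)).mul_left
  have h3 : Integrable fun r : ℝ => r ^ d * (r * radialBump r) :=
    ((continuous_pow d).mul (continuous_id.mul hb)).integrable_of_hasCompactSupport
      hcs.mul_left.mul_left
  have h4 (r : ℝ) : HasDerivAt (fun r : ℝ => r ^ d * (r * radialBump r))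
      (d * (r ^ d * radialBump r) + r ^ d * (radialBump r + r * deriv radialBump r)) r := by
    refine ((hasDerivAt_pow d r).mul
      ((hasDerivAt_id r).mul (hasDerivAt_radialBump r))).congr_deriv ?_
    rcases d with _ | d
    · simp
    · simp only [Nat.add_sub_cancel, Pi.mul_apply, id, one_mul]
      ring
  have h5 := integral_eq_zero_of_hasDerivAt_of_integrable h4 ((h1.const_mul _).add h2) h3
  rw [integral_add (h1.const_mul _) h2, integral_const_mul] at h5
  linarith

/-- A smooth radial cutoff function with support in an annulus. -/
def radialCutoff (x : Euc d) : ℂ := ((‖x‖ * radialBump ‖x‖ : ℝ) : ℂ)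

lemma radialCutoff_ne_zero {x : Euc d} (h : radialCutoff x ≠ 0) : 1 < ‖x‖ ∧ ‖x‖ < 3 :=
  radialBump_ne_zero (right_ne_zero_of_mul (Complex.ofReal_ne_zero.1 h))

lemma hasFDerivAt_norm_of_ne_zero {x : Euc d} (hx : x ≠ 0) :
    HasFDerivAt (fun x : Euc d => ‖x‖) (‖x‖⁻¹ • innerSL ℝ x) x := by
  have hn : ‖x‖ ≠ 0 := norm_ne_zero_iff.2 hx
  have h := (hasStrictFDerivAt_norm_sq x).hasFDerivAt.sqrt (by positivity)
  simp only [Real.sqrt_sq (norm_nonneg _)] at h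
  refine h.congr_fderiv ?_
  ext w
  simp
  field_simp

lemma hasFDerivAt_radialCutoff {x : Euc d} (hx : x ≠ 0) :
    HasFDerivAt radialCutoff (Complex.ofRealCLM ∘L
      (((radialBump ‖x‖ + ‖x‖ * deriv radialBump ‖x‖) * ‖x‖⁻¹) • innerSL ℝ x)) x := by
  have h2 := ((hasDerivAt_id ‖x‖).mul (hasDerivAt_radialBump ‖x‖)).comp_hasFDerivAt x
    (hasFDerivAt_norm_of_ne_zero hx)
  have h3 := Complex.ofRealCLM.hasFDerivAt.comp x h2
  refine h3.congr_fderiv ?_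
  rw [smul_smul]
  simp

lemma fderiv_radialCutoff_apply {x : Euc d} (hx : x ≠ 0) (j : Fin (d + 1)) :
    fderiv ℝ radialCutoff x (EuclideanSpace.single j 1) =
      (((radialBump ‖x‖ + ‖x‖ * deriv radialBump ‖x‖) * ‖x‖⁻¹ * x j : ℝ) : ℂ) := by
  rw [(hasFDerivAt_radialCutoff hx).fderiv]
  simp [EuclideanSpace.inner_single_right]

lemma fderiv_radialCutoff_zero : fderiv ℝ (radialCutoff (d := d)) 0 = 0 ∧
    DifferentiableAt ℝ (radialCutoff (d := d)) 0 := by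
  have h : radialCutoff (d := d) =ᶠ[𝓝 0] fun _ => 0 := by
    filter_upwards [ball_mem_nhds (0 : Euc d) one_pos] with x hx
    by_contra h
    rw [mem_ball_zero_iff] at hx
    exact lt_asymm hx (radialCutoff_ne_zero h).1
  have h2 := (hasFDerivAt_const (𝕜 := ℝ) (0 : ℂ) (0 : Euc d)).congr_of_eventuallyEq h
  exact ⟨h2.fderiv, h2.differentiableAt⟩

lemma differentiable_radialCutoff : Differentiable ℝ (radialCutoff (d := d)) := fun x => by
  by_cases hx : x = 0
  · rw [hx]
    exact fderiv_radialCutoff_zero.2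
  · exact (hasFDerivAt_radialCutoff hx).differentiableAt

/-- Integration by parts on the sphere, for a function that is homogeneous of degree `0`. -/
theorem integral_sphere_fderiv {F : Euc d → ℂ} (hF : ContDiffOn ℝ 1 F {0}ᶜ)
    (hom : ∀ (r : ℝ) (x : Euc d), 0 < r → F (r • x) = F x) (j : Fin (d + 1)) :
    ∫ u : Sph d, fderiv ℝ F u (EuclideanSpace.single j 1) ∂sphMeasure d =
      d * ∫ u : Sph d, (((u : Euc d) j : ℝ) : ℂ) * F u ∂sphMeasure d := by
  set e : Euc d := EuclideanSpace.single j 1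
  have ho : IsOpen ({0}ᶜ : Set (Euc d)) := isOpen_compl_singleton
  have hd {x : Euc d} (hx : x ≠ 0) : DifferentiableAt ℝ F x :=
    (hF.contDiffAt (ho.mem_nhds hx)).differentiableAt (by simp)
  have hfd : ContinuousOn (fun x => fderiv ℝ F x e) {0}ᶜ :=
    (hF.continuousOn_fderiv_of_isOpen ho le_rfl).clm_apply continuousOn_const
  have hc := (differentiable_radialCutoff (d := d)).continuous
  have hcd : ContinuousOn (fun x : Euc d => fderiv ℝ radialCutoff x e) {0}ᶜ := by
    have h1 : ContinuousOn (fun x : Euc d =>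
        (((radialBump ‖x‖ + ‖x‖ * deriv radialBump ‖x‖) * ‖x‖⁻¹ * x j : ℝ) : ℂ)) {0}ᶜ := by
      refine Complex.continuous_ofReal.comp_continuousOn (ContinuousOn.mul (ContinuousOn.mul
        (Continuous.continuousOn ?_) ?_) (Continuous.continuousOn ?_))
      · exact (radialBump.continuous.comp continuous_norm).add
          (continuous_norm.mul (continuous_deriv_radialBump.comp continuous_norm))
      · exact continuous_norm.continuousOn.inv₀ fun x hx => norm_ne_zero_iff.2 hx
      · fun_prop
    exact h1.congr fun x hx => fderiv_radialCutoff_apply hx j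
  have hcs {x : Euc d} (h : radialCutoff x ≠ 0) : 1 ≤ ‖x‖ ∧ ‖x‖ ≤ 3 :=
    ⟨(radialCutoff_ne_zero h).1.le, (radialCutoff_ne_zero h).2.le⟩
  have hcds {x : Euc d} (h : fderiv ℝ radialCutoff x e ≠ 0) : 1 ≤ ‖x‖ ∧ ‖x‖ ≤ 3 := by
    by_cases hx : x = 0
    · rw [hx, fderiv_radialCutoff_zero.1] at h
      exact absurd rfl h
    rw [fderiv_radialCutoff_apply hx, Complex.ofReal_ne_zero] at h
    have h2 := left_ne_zero_of_mul (left_ne_zero_of_mul h)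
    by_cases h3 : radialBump ‖x‖ = 0
    · rw [h3, zero_add] at h2
      exact deriv_radialBump_ne_zero (right_ne_zero_of_mul h2)
    · exact ⟨(radialBump_ne_zero h3).1.le, (radialBump_ne_zero h3).2.le⟩
  -- `F` need not be differentiable at 0, but differentiability is only required on the closed
  -- support of the cutoff.
  have hone : ∀ x ∈ tsupport (radialCutoff (d := d)), x ≠ 0 := by
    have hcl : IsClosed {x : Euc d | 1 ≤ ‖x‖} := isClosed_le continuous_const continuous_norm
    have hsub : tsupport (radialCutoff (d := d)) ⊆ {x : Euc d | 1 ≤ ‖x‖} :=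
      closure_minimal (fun x hx => (hcs hx).1) hcl
    rintro x hx rfl
    have := hsub hx
    norm_num at this
  -- Integrate by parts in the whole space against ‖x‖ χ(‖x‖) and pass to polar coordinates. The
  -- factor ‖x‖ cancels the degree -1 of ∂_j F, so the left side has radial part χ; the right side
  -- has radial part χ + r χ'. By `integral_pow_mul_deriv_radialBump` the two radial integrals
  -- differ by the factor -d, and the common one is positive and cancels.
  have key := integral_mul_fderiv_eq_neg_fderiv_mul_of_integrable (μ := (volume : Measure (Euc d)))
    (f := radialCutoff) (g := F) (v := e)
    (integrable_of_support_subset_annulus (hcd.mul hF.continuousOn)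
      fun x hx => hcds (left_ne_zero_of_mul hx))
    (integrable_of_support_subset_annulus (hc.continuousOn.mul hfd)
      fun x hx => hcs (left_ne_zero_of_mul hx))
    (integrable_of_support_subset_annulus (hc.continuousOn.mul hF.continuousOn)
      fun x hx => hcs (left_ne_zero_of_mul hx))
    (fun x _ => differentiable_radialCutoff x) (fun x hx => hd (hone x hx))
  have hnr (u : Sph d) {r : ℝ} (hr : 0 < r) : ‖r • (u : Euc d)‖ = r := by
    rw [norm_smul, norm_sph, mul_one, Real.norm_of_nonneg hr.le]
  have hfr (u : Sph d) {r : ℝ} (hr : 0 < r) :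
      r * fderiv ℝ F (r • (u : Euc d)) e = fderiv ℝ F u e := by
    have h1 := (hd (smul_ne_zero hr.ne' (sph_ne_zero u))).hasFDerivAt.comp (u : Euc d)
      ((hasFDerivAt_id (u : Euc d)).const_smul r)
    have h2 : F ∘ (fun x : Euc d => r • x) = F := funext fun x => hom r x hr
    have h3 : HasFDerivAt F _ (u : Euc d) := h2 ▸ h1
    rw [h3.fderiv]
    simp
  rw [integral_eq_mul_of_polar (a := fun u => fderiv ℝ F u e)
      (c := fun r => ((radialBump r : ℝ) : ℂ)) (fun u r hr => by
        rw [radialCutoff, hnr u hr, ← hfr u hr]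
        push_cast
        ring),
    integral_eq_mul_of_polar (a := fun u : Sph d => (((u : Euc d) j : ℝ) : ℂ) * F u)
      (c := fun r => ((radialBump r + r * deriv radialBump r : ℝ) : ℂ)) (fun u r hr => by
        rw [fderiv_radialCutoff_apply (smul_ne_zero hr.ne' (sph_ne_zero u)), hnr u hr,
          hom r u hr]
        have hr0 : (r : ℂ) ≠ 0 := Complex.ofReal_ne_zero.2 hr.ne'
        simp only [PiLp.smul_apply, smul_eq_mul]
        push_cast
        field_simp)] at key
  simp only [← Complex.ofReal_pow, ← Complex.ofReal_mul] at key
  rw [integral_complex_ofReal, integral_complex_ofReal, integral_pow_mul_deriv_radialBump] at key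
  have hI : ((∫ r : ℝ in Set.Ioi 0, r ^ d * radialBump r : ℝ) : ℂ) ≠ 0 :=
    Complex.ofReal_ne_zero.2 (integral_pow_mul_radialBump_pos d).ne'
  refine mul_right_cancel₀ hI (key.trans ?_)
  push_cast
  ring

/-! ### The dual Radon transform -/

lemma continuous_apply_inner (ρ : SphereSchwartz d) (x : Euc d) :
    Continuous fun u : Sph d => ρ (u, ⟪x, (u : Euc d)⟫_ℝ) :=
  ρ.continuous.comp (by fun_prop)

lemma integrable_sphere_of_continuous {f : Sph d → ℂ} (hf : Continuous f) :
    Integrable f (sphMeasure d) :=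
  hf.integrable_of_hasCompactSupport (HasCompactSupport.of_compactSpace f)

lemma integrable_apply_inner (ρ : SphereSchwartz d) (x : Euc d) :
    Integrable (fun u : Sph d => ρ (u, ⟪x, (u : Euc d)⟫_ℝ)) (sphMeasure d) :=
  integrable_sphere_of_continuous (continuous_apply_inner ρ x)

lemma dualRadon_add (ρ σ : SphereSchwartz d) (x : Euc d) :
    dualRadon (ρ + σ : SphereSchwartz d) x = dualRadon ρ x + dualRadon σ x :=
  integral_add (integrable_apply_inner ρ x) (integrable_apply_inner σ x)

lemma dualRadon_smul (c : ℂ) (ρ : SphereSchwartz d) (x : Euc d) :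
    dualRadon (c • ρ : SphereSchwartz d) x = c * dualRadon ρ x :=
  integral_const_mul c _

lemma norm_dualRadon_le {ρ : SphereSchwartz d} {C : ℝ} (hC : ∀ q, ‖ρ q‖ ≤ C) (x : Euc d) :
    ‖dualRadon ρ x‖ ≤ (sphMeasure d).real Set.univ * C := by
  rw [mul_comm]
  exact norm_integral_le_of_norm_le_const (.of_forall fun u => hC _)

/-- For fixed u, x enters only through p = x·u, so ∂_j acts as u_j ∂_p under the integral;
boundedness of ∂_p ρ and finiteness of the surface measure give the domination. -/
lemma hasFDerivAt_dualRadon (ρ : SphereSchwartz d) (x : Euc d) :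
    HasFDerivAt (dualRadon ρ)
      (∑ j, dualRadon (SphereSchwartz.mulCoord j (SphereSchwartz.derivSnd d ρ)) x •
        (Complex.ofRealCLM ∘L (EuclideanSpace.proj j : Euc d →L[ℝ] ℝ))) x := by
  let σ := SphereSchwartz.derivSnd d ρ
  let L : Sph d → (Euc d →L[ℝ] ℂ) := fun u =>
    ∑ j, (((u : Euc d) j : ℝ) : ℂ) • (Complex.ofRealCLM ∘L (EuclideanSpace.proj j : Euc d →L[ℝ] ℝ))
  have hLc : Continuous L := by
    refine continuous_finsetSum _ fun j _ => ?_
    have : Continuous fun u : Sph d => (((u : Euc d) j : ℝ) : ℂ) := by fun_prop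
    exact this.smul continuous_const
  have hL (u : Sph d) : L u = Complex.ofRealCLM ∘L (innerSL ℝ (u : Euc d)) := by
    refine ContinuousLinearMap.ext fun w => ?_
    simp [L, PiLp.inner_apply, mul_comm]
  have hLn (u : Sph d) : ‖L u‖ ≤ 1 := by
    rw [hL]
    refine ContinuousLinearMap.opNorm_le_bound _ zero_le_one fun w => ?_
    simpa [norm_sph] using abs_real_inner_le_norm (u : Euc d) w
  obtain ⟨C, hC⟩ := sphereSchwartz_bound σ 0
  have h1 : HasFDerivAt (dualRadon ρ)
      (∫ u : Sph d, σ (u, ⟪x, (u : Euc d)⟫_ℝ) • L u ∂sphMeasure d) x := by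
    refine hasFDerivAt_integral_of_dominated_of_fderiv_le (s := Set.univ) (bound := fun _ => C)
      (F' := fun z u => σ (u, ⟪z, (u : Euc d)⟫_ℝ) • L u)
      univ_mem (.of_forall fun z => (integrable_apply_inner ρ z).1) (integrable_apply_inner ρ x)
      ((continuous_apply_inner σ x).smul hLc).aestronglyMeasurable
      (.of_forall fun u z _ => ?_) (integrable_const C) (.of_forall fun u z _ => ?_)
    · rw [norm_smul]
      have := hC u ⟪z, (u : Euc d)⟫_ℝ
      rw [pow_zero, one_mul] at this
      nlinarith [hLn u, norm_nonneg (L u), norm_nonneg (σ (u, ⟪z, (u : Euc d)⟫_ℝ))]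
    · have h2 : HasFDerivAt (fun z : Euc d => ⟪z, (u : Euc d)⟫_ℝ) (innerSL ℝ (u : Euc d)) z := by
        refine (innerSL ℝ (u : Euc d)).hasFDerivAt.congr_of_eventuallyEq (.of_forall fun w => ?_)
        exact real_inner_comm _ _
      have h3 := (ρ.hasDerivAt_snd u ⟪z, (u : Euc d)⟫_ℝ).hasFDerivAt.comp z h2
      refine h3.congr_fderiv (ContinuousLinearMap.ext fun w => ?_)
      rw [hL]
      simp [σ, mul_comm]
  refine h1.congr_fderiv ?_
  simp only [L, Finset.smul_sum, smul_smul]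
  rw [integral_finsetSum]
  · refine Finset.sum_congr rfl fun j _ => ?_
    rw [integral_smul_const]
    congr 1
    refine integral_congr_ae (.of_forall fun u => ?_)
    exact mul_comm _ _
  · intro j _
    refine Integrable.smul_const (integrable_sphere_of_continuous ?_) _
    exact (continuous_apply_inner σ x).mul (by fun_prop)

/-- Integration by parts on the sphere for F(z) = Ψ(z/‖z‖, x·z/‖z‖). At a point u of the sphere the
second argument has j-th partial derivative x_j - (x·u) u_j, which is how a factor x_j becomes
available. -/
lemma integral_sphGrad_apply_inner (Ψ : SphereSchwartz d) (x : Euc d) (j : Fin (d + 1)) :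
    ∫ u : Sph d, (SphereSchwartz.sphGrad j Ψ (u, ⟪x, (u : Euc d)⟫_ℝ) +
      ((x j - ⟪x, (u : Euc d)⟫_ℝ * (u : Euc d) j : ℝ) : ℂ) *
        SphereSchwartz.derivSnd d Ψ (u, ⟪x, (u : Euc d)⟫_ℝ)) ∂sphMeasure d =
      d * dualRadon (SphereSchwartz.mulCoord j Ψ) x := by
  let c : Euc d → ℝ := fun z => ‖z‖⁻¹ * ⟪x, z⟫_ℝ
  let F : Euc d → ℂ := fun z => homExt Ψ (z, c z)
  have hc : ContDiffOn ℝ 1 c {0}ᶜ := fun z hz =>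
    (((contDiffAt_norm ℝ hz).inv (norm_ne_zero_iff.2 hz)).mul
      (contDiff_const.inner ℝ contDiff_id).contDiffAt).contDiffWithinAt
  have hF : ContDiffOn ℝ 1 F {0}ᶜ :=
    (Ψ.contDiffOn.of_le (mod_cast le_top)).comp (contDiffOn_id.prodMk hc) fun z hz => hz
  have hcu (u : Sph d) : c u = ⟪x, (u : Euc d)⟫_ℝ := by simp [c]
  have hom (r : ℝ) (z : Euc d) (hr : 0 < r) : F (r • z) = F z := by
    have hcr : c (r • z) = c z := by
      simp only [c, norm_smul, Real.norm_of_nonneg hr.le, inner_smul_right]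
      field_simp
    simp only [F, hcr]
    exact homExt_smul_fst _ hr z _
  have key := integral_sphere_fderiv hF hom j
  have h1 (u : Sph d) : F u = Ψ (u, ⟪x, (u : Euc d)⟫_ℝ) := by
    simp only [F, hcu]
    exact homExt_sph _ _ _
  have h2 (u : Sph d) : fderiv ℝ F u (EuclideanSpace.single j 1) =
      SphereSchwartz.sphGrad j Ψ (u, ⟪x, (u : Euc d)⟫_ℝ) +
      ((x j - ⟪x, (u : Euc d)⟫_ℝ * (u : Euc d) j : ℝ) : ℂ) *
        SphereSchwartz.derivSnd d Ψ (u, ⟪x, (u : Euc d)⟫_ℝ) := by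
    have hi : HasFDerivAt (fun z : Euc d => ‖z‖⁻¹)
        ((-(‖(u : Euc d)‖ ^ 2)⁻¹) • (‖(u : Euc d)‖⁻¹ • innerSL ℝ (u : Euc d))) (u : Euc d) :=
      (hasDerivAt_inv (norm_ne_zero_iff.2 (sph_ne_zero u))).comp_hasFDerivAt _
        (hasFDerivAt_norm_of_ne_zero (sph_ne_zero u))
    have h3 := (hi.mul (innerSL ℝ x).hasFDerivAt)
    have h4 : HasFDerivAt (homExt (Ψ : Sph d × ℝ → ℂ))
        (fderiv ℝ (homExt Ψ) ((u : Euc d), ⟪x, (u : Euc d)⟫_ℝ)) ((u : Euc d), c u) := by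
      rw [hcu]
      exact (Ψ.differentiableAt (sph_mem_offAxis u _)).hasFDerivAt
    have h5 := h4.comp (u : Euc d) ((hasFDerivAt_id (u : Euc d)).prodMk h3)
    have h6 : fderiv ℝ F u = _ := h5.fderiv
    rw [h6]
    have h7 (t : ℝ) : ((EuclideanSpace.single j 1, t) : Euc d × ℝ) =
        (EuclideanSpace.single j 1, 0) + t • (0, 1) := by simp
    rw [ContinuousLinearMap.comp_apply]
    refine Eq.trans (congrArg (fderiv ℝ (homExt Ψ) ((u : Euc d), ⟪x, (u : Euc d)⟫_ℝ))
      (?_ : _ = ((EuclideanSpace.single j 1,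
      x j - ⟪x, (u : Euc d)⟫_ℝ * (u : Euc d) j) : Euc d × ℝ))) ?_
    · simp [EuclideanSpace.inner_single_right]
      ring
    · rw [h7, map_add, map_smul, Complex.real_smul]
      rfl
  simp only [h1, h2] at key
  exact key

/-! ### Dual Radon transform: exchange of coordinates and derivatives, Schwartz estimates -/

namespace SphereLizorkin

/-- The operator on `𝓢₀(𝕊^d × ℝ)` that corresponds to the multiplication of the dual Radon transform
by the coordinate `x_j`. -/
def coordMul (j : Fin (d + 1)) : sphereLizorkin d →L[ℂ] sphereLizorkin d :=
  mulCoord j ∘L mulSnd d + (d : ℂ) • (mulCoord j ∘L primitive d) - sphGrad j ∘L primitive d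

/-- The operator on `𝓢₀(𝕊^d × ℝ)` that corresponds to the partial derivative `j` of the dual Radon
transform. -/
def coordDeriv (j : Fin (d + 1)) : sphereLizorkin d →L[ℂ] sphereLizorkin d :=
  mulCoord j ∘L derivSnd d

/-- The dual Radon transform as a linear map into functions. -/
def dualRadonₗ (d : ℕ) : sphereLizorkin d →ₗ[ℂ] (Euc d → ℂ) where
  toFun ρ := dualRadon (ρ : SphereSchwartz d)
  map_add' _ _ := funext fun x => dualRadon_add _ _ x
  map_smul' c _ := funext fun x => dualRadon_smul c _ x

lemma dualRadonₗ_apply (ρ : sphereLizorkin d) (x : Euc d) :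
    dualRadonₗ d ρ x =
      ∫ u : Sph d, (ρ : SphereSchwartz d) (u, ⟪x, (u : Euc d)⟫_ℝ) ∂sphMeasure d := rfl

lemma integral_add_const_mul_sub {f g h : Sph d → ℂ} (hf : Integrable f (sphMeasure d))
    (hg : Integrable g (sphMeasure d)) (hh : Integrable h (sphMeasure d)) (c : ℂ) :
    ∫ u, (f u + c * g u - h u) ∂sphMeasure d =
      ∫ u, f u ∂sphMeasure d + c * ∫ u, g u ∂sphMeasure d - ∫ u, h u ∂sphMeasure d := by
  have h1 := integral_sub (hf.add (hg.const_mul c)) hh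
  simp only [Pi.add_apply] at h1
  rw [h1, integral_add hf (hg.const_mul c),
    integral_const_mul]

/-- Take Ψ = `primitive d ρ` in `integral_sphGrad_apply_inner`. Since ∂_p Ψ = ρ, the term with x_j
is x_j R*ρ; solving for it gives `coordMul`, the factor x·u being the variable p. -/
lemma dualRadonₗ_coordMul (j : Fin (d + 1)) (ρ : sphereLizorkin d) (x : Euc d) :
    dualRadonₗ d (coordMul j ρ) x = ((x j : ℝ) : ℂ) * dualRadonₗ d ρ x := by
  have key := integral_sphGrad_apply_inner (primitive d ρ : SphereSchwartz d) x j
  have hi (σ : sphereLizorkin d) := integrable_apply_inner (σ : SphereSchwartz d) x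
  have h1 : dualRadonₗ d (coordMul j ρ) x = dualRadonₗ d (mulCoord j (mulSnd d ρ)) x +
      d * dualRadonₗ d (mulCoord j (primitive d ρ)) x -
      dualRadonₗ d (sphGrad j (primitive d ρ)) x := by
    simp [coordMul]
  have h2 : d * dualRadonₗ d (mulCoord j (primitive d ρ)) x =
      dualRadonₗ d (sphGrad j (primitive d ρ)) x + ((x j : ℝ) : ℂ) * dualRadonₗ d ρ x -
        dualRadonₗ d (mulCoord j (mulSnd d ρ)) x := by
    refine key.symm.trans ?_
    simp only [dualRadonₗ_apply]
    refine Eq.trans ?_ (integral_add_const_mul_sub (hi _) (hi _) (hi _) _)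
    refine integral_congr_ae (.of_forall fun u => ?_)
    have h3 : SphereSchwartz.derivSnd d (primitive d ρ : SphereSchwartz d) =
      (ρ : SphereSchwartz d) := derivSnd_primitiveSchwartz ρ
    simp only [h3, coe_sphGrad, mulCoord_apply, mulSnd_apply]
    push_cast
    ring
  rw [h1, h2]
  ring

lemma hasFDerivAt_dualRadonₗ (ρ : sphereLizorkin d) (x : Euc d) :
    HasFDerivAt (dualRadonₗ d ρ) (∑ j, dualRadonₗ d (coordDeriv j ρ) x •
      (Complex.ofRealCLM ∘L (EuclideanSpace.proj j : Euc d →L[ℝ] ℝ))) x :=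
  hasFDerivAt_dualRadon (ρ : SphereSchwartz d) x

lemma contDiff_dualRadonₗ (ρ : sphereLizorkin d) : ContDiff ℝ ∞ (dualRadonₗ d ρ) := by
  refine contDiff_infty.2 fun n => ?_
  induction n generalizing ρ with
  | zero =>
    exact contDiff_zero.2 (continuous_iff_continuousAt.2 fun x =>
      (hasFDerivAt_dualRadonₗ ρ x).continuousAt)
  | succ n ih =>
    rw [Nat.cast_add, Nat.cast_one, contDiff_succ_iff_fderiv]
    refine ⟨fun x => (hasFDerivAt_dualRadonₗ ρ x).differentiableAt, by simp, ?_⟩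
    have : fderiv ℝ (dualRadonₗ d ρ) = fun x => ∑ j, dualRadonₗ d (coordDeriv j ρ) x •
        (Complex.ofRealCLM ∘L (EuclideanSpace.proj j : Euc d →L[ℝ] ℝ)) :=
      funext fun x => (hasFDerivAt_dualRadonₗ ρ x).fderiv
    rw [this]
    exact ContDiff.sum fun j _ => (ih _).smul contDiff_const

lemma norm_le_sum_abs_coord (x : Euc d) : ‖x‖ ≤ ∑ j, |x j| := by
  have h : x = ∑ j, x j • EuclideanSpace.single j (1 : ℝ) := by
    ext i
    simp [Finset.sum_apply, Pi.single_apply]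
  conv_lhs => rw [h]
  refine (norm_sum_le _ _).trans (Finset.sum_le_sum fun j _ => ?_)
  simp [norm_smul]

/-- Each factor ‖x‖ is at most ∑ |x_j|, and x_j is absorbed by the continuous operator `coordMul j`.
What remains is the sup bound by the area of the sphere. -/
lemma boundedBySeminorm_pow_mul_dualRadonₗ (d k : ℕ) :
    BoundedBySeminorm fun (ρ : sphereLizorkin d) (x : Euc d) =>
      ‖x‖ ^ k * ‖dualRadonₗ d ρ x‖ := by
  induction k with
  | zero =>
    obtain ⟨q, hqc, hq⟩ := (boundedBySeminorm_apply d 0).comp (sphereLizorkin d).subtypeL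
    have hb : BoundedBySeminorm fun ρ (_ : Euc d) => q ρ := ⟨q, hqc, fun _ _ => le_rfl⟩
    refine (hb.const_mul (C := (sphMeasure d).real Set.univ) measureReal_nonneg).of_le
      fun ρ x => ?_
    rw [pow_zero, one_mul]
    exact norm_dualRadon_le (ρ := (ρ : SphereSchwartz d)) (fun y => by simpa using hq ρ y) x
  | succ k ih =>
    refine (BoundedBySeminorm.sum Finset.univ fun j _ => ih.comp (coordMul j)).of_le
      fun ρ x => ?_
    calc ‖x‖ ^ (k + 1) * ‖dualRadonₗ d ρ x‖
        = ‖x‖ ^ k * (‖x‖ * ‖dualRadonₗ d ρ x‖) := by ring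
      _ ≤ ‖x‖ ^ k * ((∑ j, |x j|) * ‖dualRadonₗ d ρ x‖) := by
        gcongr
        exact norm_le_sum_abs_coord x
      _ = _ := by
        rw [Finset.sum_mul, Finset.mul_sum]
        refine Finset.sum_congr rfl fun j _ => ?_
        rw [dualRadonₗ_coordMul, norm_mul, Complex.norm_real, Real.norm_eq_abs]

lemma boundedBySeminorm_iteratedFDeriv_dualRadonₗ (d k m : ℕ) :
    BoundedBySeminorm fun (ρ : sphereLizorkin d) (x : Euc d) =>
      ‖x‖ ^ k * ‖iteratedFDeriv ℝ m (dualRadonₗ d ρ) x‖ := by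
  induction m with
  | zero => simpa only [norm_iteratedFDeriv_zero] using boundedBySeminorm_pow_mul_dualRadonₗ d k
  | succ m ih =>
    let A : Fin (d + 1) → ℂ →L[ℝ] (Euc d →L[ℝ] ℂ) := fun j =>
      (ContinuousLinearMap.id ℝ ℂ).smulRight
        (Complex.ofRealCLM ∘L (EuclideanSpace.proj j : Euc d →L[ℝ] ℝ))
    refine (BoundedBySeminorm.sum Finset.univ fun j _ =>
      (ih.comp (coordDeriv j)).const_mul (norm_nonneg (A j))).of_le fun ρ x => ?_
    have hf : fderiv ℝ (dualRadonₗ d ρ) = fun x => ∑ j, (A j ∘ dualRadonₗ d (coordDeriv j ρ)) x :=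
      funext fun x => (hasFDerivAt_dualRadonₗ ρ x).fderiv
    have hs (j : Fin (d + 1)) : ContDiff ℝ m (dualRadonₗ d (coordDeriv j ρ)) :=
      (contDiff_dualRadonₗ _).of_le (mod_cast le_top)
    have hc (j : Fin (d + 1)) (_ : j ∈ Finset.univ) :
        ContDiffAt ℝ m (A j ∘ dualRadonₗ d (coordDeriv j ρ)) x :=
      ((A j).contDiff.comp (hs j)).contDiffAt
    rw [← norm_iteratedFDeriv_fderiv, hf, iteratedFDeriv_fun_sum_apply hc]
    calc ‖x‖ ^ k * ‖∑ j, iteratedFDeriv ℝ m (A j ∘ dualRadonₗ d (coordDeriv j ρ)) x‖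
        ≤ ‖x‖ ^ k * ∑ j, ‖A j‖ * ‖iteratedFDeriv ℝ m (dualRadonₗ d (coordDeriv j ρ)) x‖ := by
          gcongr
          exact (norm_sum_le _ _).trans (Finset.sum_le_sum fun j _ =>
            (A j).norm_iteratedFDeriv_comp_left (hs j).contDiffAt le_rfl)
      _ = _ := by
        rw [Finset.mul_sum]
        refine Finset.sum_congr rfl fun j _ => ?_
        ring

/-- The dual Radon transform as a map into Schwartz functions. -/
def dualRadonSchwartz (d : ℕ) : sphereLizorkin d →L[ℂ] 𝓢(Euc d, ℂ) :=
  let L : sphereLizorkin d →ₗ[ℂ] 𝓢(Euc d, ℂ) :=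
    { toFun := fun ρ =>
        { toFun := dualRadonₗ d ρ
          smooth' := contDiff_dualRadonₗ ρ
          decay' := fun k m => by
            obtain ⟨q, -, hq⟩ := boundedBySeminorm_iteratedFDeriv_dualRadonₗ d k m
            exact ⟨q ρ, hq ρ⟩ }
      map_add' := fun ρ σ => SchwartzMap.ext fun x => dualRadon_add _ _ x
      map_smul' := fun c ρ => SchwartzMap.ext fun x => dualRadon_smul c _ x }
  ⟨L, by
    refine (schwartz_withSeminorms ℂ (Euc d) ℂ).continuous_of_continuous_comp L fun i => ?_
    obtain ⟨q, hqc, hq⟩ := boundedBySeminorm_iteratedFDeriv_dualRadonₗ d i.1 i.2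
    exact Seminorm.continuous_of_le hqc fun ρ =>
      SchwartzMap.seminorm_le_bound ℂ i.1 i.2 _ (apply_nonneg q ρ) (hq ρ)⟩

lemma dualRadonSchwartz_apply (ρ : sphereLizorkin d) (x : Euc d) :
    dualRadonSchwartz d ρ x = dualRadonₗ d ρ x := rfl

/-! ### Vanishing moments of the dual Radon transform -/

lemma derivSnd_mulCoord (j : Fin (d + 1)) (ρ : SphereSchwartz d) (q : Sph d × ℝ) :
    SphereSchwartz.derivSnd d (SphereSchwartz.mulCoord j ρ) q =
      (((q.1 : Euc d) j : ℝ) : ℂ) * SphereSchwartz.derivSnd d ρ q :=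
  ((SphereSchwartz.mulCoord j ρ).hasDerivAt_snd q.1 q.2).unique
    ((ρ.hasDerivAt_snd q.1 q.2).const_mul (((q.1 : Euc d) j : ℝ) : ℂ))

lemma integral_fderiv_schwartz_apply (f : 𝓢(Euc d, ℂ)) (w : Euc d) :
    ∫ x, fderiv ℝ f x w = 0 := by
  have h1 : Integrable fun x => fderiv ℝ f x w :=
    (SchwartzMap.evalCLM ℝ (Euc d) ℂ w (SchwartzMap.fderivCLM ℝ (Euc d) ℂ f)).integrable
  have h := integral_mul_fderiv_eq_neg_fderiv_mul_of_integrable (μ := (volume : Measure (Euc d)))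
    (f := fun _ => (1 : ℂ)) (g := f) (v := w) (by simp) (by simpa using h1)
    (by simpa using f.integrable) (fun _ _ => by fun_prop) (fun _ _ => f.differentiableAt)
  simpa using h

/-- With Ψ the primitive of `ρ`, ∑ ∂_j R*(u_j Ψ) = R*(∑ u_j² ∂_p Ψ) = R*ρ because |u| = 1. So R*ρ is
the divergence of a Schwartz vector field. -/
lemma integral_dualRadonₗ (ρ : sphereLizorkin d) : ∫ x, dualRadonₗ d ρ x = 0 := by
  let f : Fin (d + 1) → 𝓢(Euc d, ℂ) := fun j => dualRadonSchwartz d (mulCoord j (primitive d ρ))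
  have h (x : Euc d) : dualRadonₗ d ρ x =
      ∑ j, fderiv ℝ (f j) x (EuclideanSpace.single j 1) := by
    have h1 (j : Fin (d + 1)) : fderiv ℝ (f j) x (EuclideanSpace.single j 1) =
        dualRadonₗ d (coordDeriv j (mulCoord j (primitive d ρ))) x := by
      have h2 : HasFDerivAt (f j) _ x :=
        hasFDerivAt_dualRadonₗ (mulCoord j (primitive d ρ)) x
      rw [h2.fderiv, _root_.sum_apply, Finset.sum_eq_single j]
      · simp
      · intro i _ hij
        simp [hij]
      · simp
    simp only [h1, dualRadonₗ_apply]
    rw [← integral_finsetSum _ fun j _ => integrable_apply_inner _ x]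
    refine integral_congr_ae (.of_forall fun u => ?_)
    have h3 : ∑ j, ((((u : Euc d) j : ℝ) : ℂ)) ^ 2 = 1 := by
      have := EuclideanSpace.real_norm_sq_eq (u : Euc d)
      rw [norm_sph, one_pow] at this
      exact_mod_cast this.symm
    have h4 : SphereSchwartz.derivSnd d (primitive d ρ : SphereSchwartz d) =
      (ρ : SphereSchwartz d) := derivSnd_primitiveSchwartz ρ
    have h5 (j : Fin (d + 1)) : (coordDeriv j (mulCoord j (primitive d ρ)) : SphereSchwartz d)
        (u, ⟪x, (u : Euc d)⟫_ℝ) =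
        (((u : Euc d) j : ℝ) : ℂ) ^ 2 * (ρ : SphereSchwartz d) (u, ⟪x, (u : Euc d)⟫_ℝ) := by
      rw [pow_two, mul_assoc, ← h4]
      exact congrArg ((((u : Euc d) j : ℝ) : ℂ) * ·)
        (derivSnd_mulCoord j (primitive d ρ : SphereSchwartz d) (u, ⟪x, (u : Euc d)⟫_ℝ))
    simp only [h5]
    rw [← Finset.sum_mul, h3, one_mul]
  simp only [h]
  rw [integral_finsetSum]
  · exact Finset.sum_eq_zero fun j _ => integral_fderiv_schwartz_apply (f j) _
  · exact fun j _ => (SchwartzMap.evalCLM ℝ (Euc d) ℂ _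
      (SchwartzMap.fderivCLM ℝ (Euc d) ℂ (f j))).integrable

/-- Iterating `coordMul` reduces every moment of R*ρ to the total integral of some R*σ. -/
lemma exists_prod_mul_dualRadonₗ (m : Fin (d + 1) → ℕ) (s : Finset (Fin (d + 1)))
    (ρ : sphereLizorkin d) : ∃ σ : sphereLizorkin d, ∀ x : Euc d,
      ((∏ i ∈ s, x i ^ m i : ℝ) : ℂ) * dualRadonₗ d ρ x = dualRadonₗ d σ x := by
  have hpow (j : Fin (d + 1)) (n : ℕ) (σ : sphereLizorkin d) : ∃ τ : sphereLizorkin d,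
      ∀ x : Euc d, ((x j ^ n : ℝ) : ℂ) * dualRadonₗ d σ x = dualRadonₗ d τ x := by
    induction n with
    | zero => exact ⟨σ, fun x => by simp⟩
    | succ n ih =>
      obtain ⟨τ, hτ⟩ := ih
      refine ⟨coordMul j τ, fun x => ?_⟩
      rw [dualRadonₗ_coordMul, ← hτ x]
      push_cast
      ring
  induction s using Finset.induction_on with
  | empty => exact ⟨ρ, fun x => by simp⟩
  | insert j s hj ih =>
    obtain ⟨σ, hσ⟩ := ih
    obtain ⟨τ, hτ⟩ := hpow j (m j) σ
    refine ⟨τ, fun x => ?_⟩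
    rw [← hτ x, ← hσ x, Finset.prod_insert hj, Complex.ofReal_mul, mul_assoc]

/-- The dual Radon transform on the Lizorkin space. -/
def dualRadonCLM (d : ℕ) : sphereLizorkin d →L[ℂ] lizorkin d :=
  (dualRadonSchwartz d).codRestrict (lizorkin d) fun ρ m => by
    obtain ⟨σ, hσ⟩ := exists_prod_mul_dualRadonₗ m Finset.univ ρ
    simp only [dualRadonSchwartz_apply, hσ]
    exact integral_dualRadonₗ σ

lemma dualRadonCLM_apply (ρ : sphereLizorkin d) (x : Euc d) :
    (dualRadonCLM d ρ : 𝓢(Euc d, ℂ)) x = dualRadon (ρ : SphereSchwartz d) x := rfl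

end SphereLizorkin

/-! ### Hyperplanes -/

lemma finrank_orthogonal_sph (u : Sph d) : Module.finrank ℝ (ℝ ∙ (u : Euc d))ᗮ = d := by
  have := Fact.mk (@finrank_euclideanSpace_fin ℝ _ (d + 1))
  exact Submodule.finrank_orthogonal_span_singleton (sph_ne_zero u)

/-- A linear isometry of `ℝ^d` onto the orthogonal complement of `u`. -/
def frame (u : Sph d) : EuclideanSpace ℝ (Fin d) →ₗᵢ[ℝ] Euc d :=
  (ℝ ∙ (u : Euc d))ᗮ.subtypeₗᵢ.comp ((stdOrthonormalBasis ℝ (ℝ ∙ (u : Euc d))ᗮ).reindex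
    (finCongr (finrank_orthogonal_sph u))).repr.symm.toLinearIsometry

lemma frame_mem (u : Sph d) (y : EuclideanSpace ℝ (Fin d)) :
    frame u y ∈ (ℝ ∙ (u : Euc d))ᗮ := Subtype.coe_prop _

lemma inner_frame (u : Sph d) (y : EuclideanSpace ℝ (Fin d)) : ⟪frame u y, (u : Euc d)⟫_ℝ = 0 :=
  Submodule.mem_orthogonal_singleton_iff_inner_left.1 (frame_mem u y)

lemma exists_frame_eq {u : Sph d} {x : Euc d} (hx : ⟪x, (u : Euc d)⟫_ℝ = 0) :
    ∃ y, frame u y = x := by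
  let x' : (ℝ ∙ (u : Euc d))ᗮ := ⟨x, Submodule.mem_orthogonal_singleton_iff_inner_left.2 hx⟩
  exact ⟨((stdOrthonormalBasis ℝ (ℝ ∙ (u : Euc d))ᗮ).reindex
    (finCongr (finrank_orthogonal_sph u))).repr x', by simp [frame, x']⟩

/-- The parametrization of the hyperplane `{x | x·u = p}` by `ℝ^d`. -/
def slice (u : Sph d) (p : ℝ) (y : EuclideanSpace ℝ (Fin d)) : Euc d := p • (u : Euc d) + frame u y

lemma inner_slice (u : Sph d) (p : ℝ) (y : EuclideanSpace ℝ (Fin d)) :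
    ⟪slice u p y, (u : Euc d)⟫_ℝ = p := by
  rw [slice, inner_add_left, inner_frame, add_zero, real_inner_smul_left,
    real_inner_self_eq_norm_sq, norm_sph, one_pow, mul_one]

lemma norm_slice_sq (u : Sph d) (p : ℝ) (y : EuclideanSpace ℝ (Fin d)) :
    ‖slice u p y‖ ^ 2 = p ^ 2 + ‖y‖ ^ 2 := by
  rw [slice, norm_add_sq_real, real_inner_smul_left, real_inner_comm, inner_frame, norm_smul,
    norm_sph, (frame u).norm_map, Real.norm_eq_abs, mul_one, sq_abs]
  ring

lemma abs_le_norm_slice (u : Sph d) (p : ℝ) (y : EuclideanSpace ℝ (Fin d)) :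
    |p| ≤ ‖slice u p y‖ :=
  (sq_le_sq₀ (abs_nonneg p) (norm_nonneg _)).1 (by
    rw [sq_abs, norm_slice_sq]; nlinarith [sq_nonneg ‖y‖])

lemma norm_le_norm_slice (u : Sph d) (p : ℝ) (y : EuclideanSpace ℝ (Fin d)) :
    ‖y‖ ≤ ‖slice u p y‖ :=
  le_of_sq_le_sq (by rw [norm_slice_sq]; nlinarith [sq_nonneg p]) (norm_nonneg _)

lemma continuous_slice (u : Sph d) :
    Continuous fun z : ℝ × EuclideanSpace ℝ (Fin d) => slice u z.1 z.2 :=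
  (continuous_fst.smul continuous_const).add ((frame u).continuous.comp continuous_snd)

lemma isometry_slice (u : Sph d) (p : ℝ) : Isometry (slice u p) :=
  (IsometryEquiv.addLeft (p • (u : Euc d))).isometry.comp (frame u).isometry

lemma range_slice (u : Sph d) (p : ℝ) :
    Set.range (slice u p) = {x : Euc d | ⟪x, (u : Euc d)⟫_ℝ = p} := by
  ext x
  constructor
  · rintro ⟨y, rfl⟩
    exact inner_slice u p y
  · intro hx
    have h : ⟪x - p • (u : Euc d), (u : Euc d)⟫_ℝ = 0 := by
      rw [inner_sub_left, real_inner_smul_left, real_inner_self_eq_norm_sq, norm_sph,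
        show ⟪x, (u : Euc d)⟫_ℝ = p from hx]
      ring
    obtain ⟨y, hy⟩ := exists_frame_eq h
    exact ⟨y, by rw [slice, hy]; abel⟩

/-- An isometry carries Hausdorff measure to Hausdorff measure on its range, and on ℝ^d the
normalized Hausdorff measure is Lebesgue measure. -/
lemma radon_eq_integral_slice (f : Euc d → ℂ) (u : Sph d) (p : ℝ) :
    radon f (u, p) = ∫ y, f (slice u p y) := by
  have h := (isometry_slice u p).map_euclideanHausdorffMeasure (d := d)
  rw [EuclideanSpace.euclideanHausdorffMeasure_eq_volume, range_slice] at h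
  rw [radon, ← h]
  exact (isometry_slice u p).isClosedEmbedding.measurableEmbedding.integral_map f

/-- For the Euclidean norm on ℝ × ℝ^d the map is a linear isometry between spaces of equal
dimension, and passing to that norm does not change the product measure. -/
lemma measurePreserving_slice (u : Sph d) :
    MeasurePreserving fun z : ℝ × EuclideanSpace ℝ (Fin d) => slice u z.1 z.2 := by
  let L : WithLp 2 (ℝ × EuclideanSpace ℝ (Fin d)) →ₗᵢ[ℝ] Euc d :=
    { toFun := fun z => slice u z.fst z.snd
      map_add' := fun z w => by simp [slice, add_smul]; abel
      map_smul' := fun c z => by simp [slice, mul_smul]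
      norm_map' := fun z => by
        have h : ‖slice u z.fst z.snd‖ ^ 2 = ‖z‖ ^ 2 := by
          rw [norm_slice_sq, WithLp.prod_norm_sq_eq_of_L2, Real.norm_eq_abs, sq_abs]
        exact (sq_eq_sq₀ (norm_nonneg _) (norm_nonneg _)).1 h }
  have hrank : Module.finrank ℝ (WithLp 2 (ℝ × EuclideanSpace ℝ (Fin d))) =
      Module.finrank ℝ (Euc d) := by
    rw [(WithLp.linearEquiv 2 ℝ (ℝ × EuclideanSpace ℝ (Fin d))).finrank_eq]
    simp [add_comm]
  exact (L.toLinearIsometryEquiv hrank).measurePreserving.comp (WithLp.volume_preserving_toLp _ _)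

lemma measurableEmbedding_slice (u : Sph d) :
    MeasurableEmbedding fun z : ℝ × EuclideanSpace ℝ (Fin d) => slice u z.1 z.2 := by
  refine (continuous_slice u).measurableEmbedding fun z w h => ?_
  have h' : slice u z.1 z.2 = slice u w.1 w.2 := h
  have h1 : z.1 = w.1 := by rw [← inner_slice u z.1 z.2, h', inner_slice]
  rw [h1] at h'
  exact Prod.ext h1 ((isometry_slice u w.1).injective h')

lemma integrable_slice {f : Euc d → ℂ} (hf : Integrable f) (u : Sph d) :
    Integrable fun z : ℝ × EuclideanSpace ℝ (Fin d) => f (slice u z.1 z.2) :=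
  ((measurePreserving_slice u).integrable_comp_emb (measurableEmbedding_slice u)).2 hf

lemma integrable_integral_slice {f : Euc d → ℂ} (hf : Integrable f) (u : Sph d) :
    Integrable fun p => ∫ y, f (slice u p y) :=
  (integrable_slice hf u).integral_prod_left

/-- Fubini's theorem for the foliation of `ℝ^(d+1)` by the hyperplanes orthogonal to `u`. -/
lemma integral_integral_slice {f : Euc d → ℂ} (hf : Integrable f) (u : Sph d) :
    ∫ p, ∫ y, f (slice u p y) = ∫ x, f x := by
  rw [← (measurePreserving_slice u).integral_comp (measurableEmbedding_slice u)]
  exact (integral_prod (fun z : ℝ × EuclideanSpace ℝ (Fin d) => f (slice u z.1 z.2))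
    (integrable_slice hf u)).symm

lemma integrable_one_add_norm_pow_inv (d : ℕ) :
    Integrable fun y : EuclideanSpace ℝ (Fin d) => ((1 + ‖y‖) ^ (d + 1))⁻¹ := by
  have h := integrable_one_add_norm (μ := (volume : Measure (EuclideanSpace ℝ (Fin d))))
    (r := (d + 1 : ℕ)) (by simp)
  refine h.congr (.of_forall fun y => ?_)
  simp only
  rw [Real.rpow_neg (by positivity), Real.rpow_natCast]

/-- The norm of a point of the hyperplane dominates both |p| and ‖y‖, so k powers of the weight go
to p and d + 1 powers to y, enough for integrability on ℝ^d. -/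
lemma norm_apply_slice_le {φ : 𝓢(Euc d, ℂ)} {k : ℕ} {C : ℝ}
    (hC : ∀ x, (1 + ‖x‖) ^ (k + (d + 1)) * ‖φ x‖ ≤ C) (u : Sph d) (p : ℝ)
    (y : EuclideanSpace ℝ (Fin d)) :
    (1 + |p|) ^ k * ‖φ (slice u p y)‖ ≤ C * ((1 + ‖y‖) ^ (d + 1))⁻¹ := by
  rw [← div_eq_mul_inv, le_div_iff₀ (by positivity)]
  refine le_trans ?_ (hC (slice u p y))
  have h1 := abs_le_norm_slice u p y
  have h2 := norm_le_norm_slice u p y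
  calc (1 + |p|) ^ k * ‖φ (slice u p y)‖ * (1 + ‖y‖) ^ (d + 1)
      ≤ (1 + ‖slice u p y‖) ^ k * ‖φ (slice u p y)‖ * (1 + ‖slice u p y‖) ^ (d + 1) := by gcongr
    _ = (1 + ‖slice u p y‖) ^ (k + (d + 1)) * ‖φ (slice u p y)‖ := by ring

lemma norm_integral_slice_le {φ : 𝓢(Euc d, ℂ)} {k : ℕ} {C : ℝ}
    (hC : ∀ x, (1 + ‖x‖) ^ (k + (d + 1)) * ‖φ x‖ ≤ C) (u : Sph d) (p : ℝ) :
    (1 + |p|) ^ k * ‖∫ y, φ (slice u p y)‖ ≤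
      (∫ y : EuclideanSpace ℝ (Fin d), ((1 + ‖y‖) ^ (d + 1))⁻¹) * C := by
  have h := norm_integral_le_of_norm_le ((integrable_one_add_norm_pow_inv d).const_mul C)
    (f := fun y => (1 + |p| : ℝ) ^ k • φ (slice u p y)) (.of_forall fun y => by
      rw [norm_smul, norm_pow, Real.norm_of_nonneg (by positivity)]
      exact norm_apply_slice_le hC u p y)
  rwa [integral_smul, norm_smul, norm_pow, Real.norm_of_nonneg (by positivity),
    integral_const_mul, mul_comm C] at h

lemma continuous_integral_slice (φ : 𝓢(Euc d, ℂ)) (u : Sph d) :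
    Continuous fun p => ∫ y, φ (slice u p y) := by
  obtain ⟨q, -, hq⟩ := boundedBySeminorm_schwartz (E := Euc d) (0 + (d + 1)) 0
  have hC (x : Euc d) : (1 + ‖x‖) ^ (0 + (d + 1)) * ‖φ x‖ ≤ q φ := by
    simpa only [norm_iteratedFDeriv_zero] using hq φ x
  refine continuous_of_dominated (fun p => ?_) (fun p => .of_forall fun y => ?_)
    ((integrable_one_add_norm_pow_inv d).const_mul (q φ)) (.of_forall fun y => ?_)
  · exact (φ.continuous.comp (isometry_slice u p).continuous).aestronglyMeasurable
  · simpa using norm_apply_slice_le hC u p y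
  · exact φ.continuous.comp ((continuous_slice u).comp (continuous_id.prodMk continuous_const))

/-! ### The Fourier slice theorem -/

open FourierTransform in
-- The character with frequency σu is constant on each hyperplane orthogonal to u, so Fubini along
-- these hyperplanes gives the claim.
lemma fourier_integral_slice (φ : 𝓢(Euc d, ℂ)) (u : Sph d) (σ : ℝ) :
    𝓕 (fun p => ∫ y, φ (slice u p y)) σ = (𝓕 φ) (σ • (u : Euc d)) := by
  rw [SchwartzMap.fourier_coe, Real.fourier_real_eq, Real.fourier_eq]
  have hf : Integrable fun x : Euc d => Real.fourierChar (-⟪x, σ • (u : Euc d)⟫_ℝ) • φ x := by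
    refine φ.integrable.mono ?_ (.of_forall fun x => by rw [Circle.norm_smul])
    have : Continuous fun x : Euc d => Real.fourierChar (-⟪x, σ • (u : Euc d)⟫_ℝ) • φ x := by
      exact (Real.continuous_fourierChar.comp (by fun_prop)).smul φ.continuous
    exact this.aestronglyMeasurable
  rw [← integral_integral_slice hf u]
  refine integral_congr_ae (.of_forall fun p => ?_)
  simp only [real_inner_smul_right, inner_slice, mul_comm σ p, Circle.smul_def]
  rw [integral_smul]

lemma norm_apply_smul_sph_le {Φ : 𝓢(Euc d, ℂ)} {C : ℝ}
    (hC : ∀ x, (1 + ‖x‖) ^ 2 * ‖Φ x‖ ≤ C) {x : Euc d} (hx : ‖x‖ = 1) (σ : ℝ) :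
    ‖Φ (σ • x)‖ ≤ C * (1 + σ ^ 2)⁻¹ := by
  rw [← div_eq_mul_inv, le_div_iff₀ (by positivity), mul_comm]
  refine le_trans ?_ (hC (σ • x))
  rw [norm_smul, hx, mul_one, Real.norm_eq_abs]
  gcongr
  nlinarith [sq_abs σ, abs_nonneg σ]

lemma exists_norm_apply_smul_sph_le (Φ : 𝓢(Euc d, ℂ)) : ∃ C : ℝ, 0 ≤ C ∧ ∀ x : Euc d, ‖x‖ = 1 →
    ∀ σ : ℝ, ‖Φ (σ • x)‖ ≤ C * (1 + σ ^ 2)⁻¹ := by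
  obtain ⟨q, -, hq⟩ := boundedBySeminorm_schwartz (E := Euc d) 2 0
  have hC (x : Euc d) : (1 + ‖x‖) ^ 2 * ‖Φ x‖ ≤ q Φ := by
    simpa only [norm_iteratedFDeriv_zero] using hq Φ x
  exact ⟨q Φ, apply_nonneg q Φ, fun x hx σ => norm_apply_smul_sph_le hC hx σ⟩

lemma integrable_apply_smul_sph (Φ : 𝓢(Euc d, ℂ)) {x : Euc d} (hx : ‖x‖ = 1) :
    Integrable fun σ : ℝ => Φ (σ • x) := by
  obtain ⟨C, -, h⟩ := exists_norm_apply_smul_sph_le Φ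
  exact (integrable_inv_one_add_sq.const_mul C).mono'
    (Φ.continuous.comp (by fun_prop)).aestronglyMeasurable (.of_forall (h x hx))

open FourierTransform in
-- Fourier inversion on the line. The gain is in the dependence on u: `frame u` is an arbitrary
-- choice without any regularity in u, whereas here u only enters as the argument of a Schwartz
-- function.
lemma integral_slice_eq (φ : 𝓢(Euc d, ℂ)) (u : Sph d) (p : ℝ) :
    ∫ y, φ (slice u p y) =
      ∫ σ : ℝ, Complex.exp ((2 * Real.pi * (σ * p) : ℝ) * Complex.I) *
        (𝓕 φ) (σ • (u : Euc d)) := by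
  have h1 := (continuous_integral_slice φ u).fourierInv_fourier_eq
    (integrable_integral_slice φ.integrable u) (by
      simp only [funext fun σ => fourier_integral_slice φ u σ]
      exact integrable_apply_smul_sph _ (norm_sph u))
  have h2 := congrFun h1 p
  rw [Real.fourierInv_eq'] at h2
  rw [← h2]
  refine integral_congr_ae (.of_forall fun σ => ?_)
  simp only [fourier_integral_slice, smul_eq_mul]
  simp [mul_comm]

/-! ### The Radon transform -/

/-- Multiplication of Schwartz functions by the coordinate `x_j`. -/
def mulCoordSchwartz (j : Fin (d + 1)) : 𝓢(Euc d, ℂ) →L[ℂ] 𝓢(Euc d, ℂ) :=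
  SchwartzMap.smulLeftCLM ℂ (Complex.ofRealCLM ∘L (EuclideanSpace.proj j : Euc d →L[ℝ] ℝ))

lemma mulCoordSchwartz_apply (j : Fin (d + 1)) (Φ : 𝓢(Euc d, ℂ)) (x : Euc d) :
    mulCoordSchwartz j Φ x = (x j : ℂ) * Φ x := by
  rw [mulCoordSchwartz, SchwartzMap.smulLeftCLM_apply_apply
    (ContinuousLinearMap.hasTemperateGrowth _)]
  rfl

/-- The partial derivative of Schwartz functions with respect to `x_j`. -/
def partialSchwartz (j : Fin (d + 1)) : 𝓢(Euc d, ℂ) →L[ℂ] 𝓢(Euc d, ℂ) :=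
  SchwartzMap.evalCLM ℂ (Euc d) ℂ (EuclideanSpace.single j (1 : ℝ)) ∘L
    SchwartzMap.fderivCLM ℂ (Euc d) ℂ

lemma fderiv_eq_sum_partialSchwartz (Φ : 𝓢(Euc d, ℂ)) (x w : Euc d) :
    fderiv ℝ Φ x w = ∑ j, (w j : ℂ) * partialSchwartz j Φ x := by
  conv_lhs => rw [← (EuclideanSpace.basisFun (Fin (d + 1)) ℝ).sum_repr w]
  simp [map_sum, partialSchwartz]

/-- The unit vector in the direction of `x`. -/
def direction (x : Euc d) : Euc d := ‖x‖⁻¹ • x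

lemma norm_direction {x : Euc d} (hx : x ≠ 0) : ‖direction x‖ = 1 := by
  rw [direction, norm_smul, norm_inv, norm_norm, inv_mul_cancel₀ (norm_ne_zero_iff.2 hx)]

lemma contDiffOn_direction_apply (j : Fin (d + 1)) :
    ContDiffOn ℝ ∞ (fun x : Euc d => direction x j) {0}ᶜ :=
  SphereSchwartz.isMultiplier_normalize_coord j

/-- For a unit vector, σ = ∑ w_l (σ w_l), and σ w_l is a coordinate of the point σw. Factors of σ
are thereby absorbed into Schwartz functions. -/
lemma mul_apply_smul_eq_sum {w : Euc d} (hw : ‖w‖ = 1) (Φ : 𝓢(Euc d, ℂ)) (σ : ℝ) :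
    (σ : ℂ) * Φ (σ • w) = ∑ l, (w l : ℂ) * mulCoordSchwartz l Φ (σ • w) := by
  have h : ∑ l, w l ^ 2 = 1 := by
    have := EuclideanSpace.real_norm_sq_eq w
    rw [← this, hw, one_pow]
  have h' : ∑ l, (w l : ℂ) ^ 2 = 1 := by exact_mod_cast h
  calc (σ : ℂ) * Φ (σ • w) = (∑ l, (w l : ℂ) ^ 2) * (σ * Φ (σ • w)) := by rw [h', one_mul]
    _ = _ := by
      rw [Finset.sum_mul]
      refine Finset.sum_congr rfl fun l _ => ?_
      rw [mulCoordSchwartz_apply, PiLp.smul_apply, smul_eq_mul]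
      push_cast
      ring

/-- The integrand of the inverse Fourier transform along the line spanned by `y.1`. -/
def rayIntegrand (Φ : 𝓢(Euc d, ℂ)) (y : Euc d × ℝ) (σ : ℝ) : ℂ :=
  Complex.exp ((2 * Real.pi * (σ * y.2) : ℝ) * Complex.I) * Φ (σ • direction y.1)

lemma norm_rayIntegrand (Φ : 𝓢(Euc d, ℂ)) (y : Euc d × ℝ) (σ : ℝ) :
    ‖rayIntegrand Φ y σ‖ = ‖Φ (σ • direction y.1)‖ := by
  rw [rayIntegrand, norm_mul, Complex.norm_exp_ofReal_mul_I, one_mul]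

lemma continuous_rayIntegrand (Φ : 𝓢(Euc d, ℂ)) (y : Euc d × ℝ) :
    Continuous (rayIntegrand Φ y) := by
  have h : Continuous fun σ : ℝ => Φ (σ • direction y.1) := Φ.continuous.comp (by fun_prop)
  have h2 : Continuous fun σ : ℝ => Complex.exp ((2 * Real.pi * (σ * y.2) : ℝ) * Complex.I) := by
    fun_prop
  exact h2.mul h

lemma integrable_rayIntegrand (Φ : 𝓢(Euc d, ℂ)) {y : Euc d × ℝ} (hy : y ∈ offAxis d) :
    Integrable (rayIntegrand Φ y) :=
  (integrable_apply_smul_sph Φ (norm_direction hy)).mono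
    (continuous_rayIntegrand Φ y).aestronglyMeasurable
    (.of_forall fun σ => (norm_rayIntegrand Φ y σ).le)

/-- The operators that occur in the derivative of `rayIntegrand`. -/
def rayOperator (i : Fin (d + 1) × Option (Fin (d + 1))) : 𝓢(Euc d, ℂ) →L[ℂ] 𝓢(Euc d, ℂ) :=
  mulCoordSchwartz i.1 ∘L i.2.elim (.id ℂ _) partialSchwartz

/-- The coefficients of the derivative of `rayIntegrand`. -/
def rayCoeff (i : Fin (d + 1) × Option (Fin (d + 1))) (y : Euc d × ℝ) : Euc d × ℝ →L[ℝ] ℂ :=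
  direction y.1 i.1 • i.2.elim
    ((2 * Real.pi * Complex.I : ℂ) • (Complex.ofRealCLM ∘L ContinuousLinearMap.snd ℝ (Euc d) ℝ))
    fun k => Complex.ofRealCLM ∘L fderiv ℝ (fun x : Euc d => direction x k) y.1 ∘L
      ContinuousLinearMap.fst ℝ (Euc d) ℝ

lemma isMultiplier_rayCoeff (i : Fin (d + 1) × Option (Fin (d + 1))) :
    IsMultiplier (rayCoeff (d := d) i) := by
  obtain ⟨l, _ | k⟩ := i
  · exact isMultiplier_comp_fst (d := d) (b := fun x => direction x l • _)
      ((contDiffOn_direction_apply l).smul contDiffOn_const)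
  · refine isMultiplier_comp_fst (d := d) (b := fun x => direction x l • (Complex.ofRealCLM ∘L
      fderiv ℝ (fun x : Euc d => direction x k) x ∘L ContinuousLinearMap.fst ℝ (Euc d) ℝ))
      ((contDiffOn_direction_apply l).smul (contDiffOn_const.clm_comp
        (((contDiffOn_direction_apply k).fderiv_of_isOpen isOpen_compl_singleton ?_).clm_comp
          contDiffOn_const)))
    exact le_rfl

/-- Differentiating the exponential in p or `Φ` in x brings down one factor σ, absorbed by
`mul_apply_smul_eq_sum`. The index (l, none) stands for the derivative in p, the index (l, some k)
for the k-th partial derivative of `Φ`; l is the coordinate that absorbs σ. -/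
lemma hasFDerivAt_rayIntegrand (Φ : 𝓢(Euc d, ℂ)) {y : Euc d × ℝ} (hy : y ∈ offAxis d) (σ : ℝ) :
    HasFDerivAt (fun z => rayIntegrand Φ z σ)
      (∑ i, rayIntegrand (rayOperator i Φ) y σ • rayCoeff i y) y := by
  have hd (k : Fin (d + 1)) : HasFDerivAt (fun x : Euc d => direction x k)
      (fderiv ℝ (fun x : Euc d => direction x k) y.1) y.1 :=
    (((contDiffOn_direction_apply k).contDiffAt
      (isOpen_compl_singleton.mem_nhds hy)).differentiableAt (by simp)).hasFDerivAt
  have h1 : HasFDerivAt (fun z : Euc d × ℝ => direction z.1)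
      (((PiLp.continuousLinearEquiv 2 ℝ fun _ : Fin (d + 1) => ℝ).symm :
          (Fin (d + 1) → ℝ) →L[ℝ] Euc d) ∘L
        (ContinuousLinearMap.pi fun k => fderiv ℝ (fun x : Euc d => direction x k) y.1) ∘L
          ContinuousLinearMap.fst ℝ (Euc d) ℝ) y := by
    have := (hasFDerivAt_pi.2 hd).comp y (hasFDerivAt_fst (𝕜 := ℝ) (p := y))
    exact (PiLp.continuousLinearEquiv 2 ℝ fun _ : Fin (d + 1) => ℝ).symm.toContinuousLinearMap
      |>.hasFDerivAt.comp y this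
  have h2 := (Φ.hasFDerivAt (σ • direction y.1)).comp y (h1.const_smul σ)
  have h3 : HasFDerivAt (fun z : Euc d × ℝ => ((2 * Real.pi * (σ * z.2) : ℝ) : ℂ) * Complex.I)
      ((2 * Real.pi * σ * Complex.I : ℂ) •
        (Complex.ofRealCLM ∘L ContinuousLinearMap.snd ℝ (Euc d) ℝ)) y := by
    refine (((Complex.ofRealCLM ∘L ContinuousLinearMap.snd ℝ (Euc d) ℝ).hasFDerivAt
      (x := y)).const_mul (2 * Real.pi * σ * Complex.I : ℂ)).congr_of_eventuallyEq
      (.of_forall fun z => ?_)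
    simp
    ring
  refine (h3.cexp.mul h2).congr_fderiv (ContinuousLinearMap.ext fun w => ?_)
  have e1 := mul_apply_smul_eq_sum (norm_direction hy) Φ σ
  have e2 (k : Fin (d + 1)) :=
    mul_apply_smul_eq_sum (norm_direction hy) (partialSchwartz k Φ) σ
  have e3 : ∑ i, (rayIntegrand (rayOperator i Φ) y σ • rayCoeff i y) w =
      Complex.exp ((2 * Real.pi * (σ * y.2) : ℝ) * Complex.I) *
        (2 * Real.pi * Complex.I * w.2 * (σ * Φ (σ • direction y.1)) +
          ∑ k, (fderiv ℝ (fun x : Euc d => direction x k) y.1 w.1 : ℂ) *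
            (σ * partialSchwartz k Φ (σ • direction y.1))) := by
    simp only [e1, e2, Finset.mul_sum, Fintype.sum_prod_type, Fintype.sum_option, mul_add]
    rw [Finset.sum_add_distrib, Finset.sum_comm (s := Finset.univ) (t := Finset.univ)]
    congr 1
    · refine Finset.sum_congr rfl fun l _ => ?_
      simp [rayOperator, rayCoeff, rayIntegrand]
      ring
    · refine Finset.sum_congr rfl fun k _ => Finset.sum_congr rfl fun l _ => ?_
      simp [rayOperator, rayCoeff, rayIntegrand]
      ring
  rw [_root_.sum_apply, e3]
  have e4 : ∑ k, (fderiv ℝ (fun x : Euc d => direction x k) y.1 w.1 : ℂ) *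
      (σ * partialSchwartz k Φ (σ • direction y.1)) = σ *
        ∑ k, (fderiv ℝ (fun x : Euc d => direction x k) y.1 w.1 : ℂ) *
          partialSchwartz k Φ (σ • direction y.1) := by
    rw [Finset.mul_sum]
    exact Finset.sum_congr rfl fun k _ => mul_left_comm _ _ _
  rw [e4]
  simp [fderiv_eq_sum_partialSchwartz]
  ring

lemma hasFDerivAt_integral_rayIntegrand (Φ : 𝓢(Euc d, ℂ)) {y : Euc d × ℝ} (hy : y ∈ offAxis d) :
    HasFDerivAt (fun z => ∫ σ, rayIntegrand Φ z σ)
      (∑ i, (∫ σ, rayIntegrand (rayOperator i Φ) y σ) • rayCoeff i y) y := by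
  choose C hC h using fun i => exists_norm_apply_smul_sph_le (rayOperator i Φ)
  have hint (i : Fin (d + 1) × Option (Fin (d + 1))) (_ : i ∈ Finset.univ) :
      Integrable fun σ => rayIntegrand (rayOperator i Φ) y σ • rayCoeff i y :=
    (integrable_rayIntegrand _ hy).smul_const _
  -- The decay of the Schwartz functions along rays is uniform in the direction, so only the
  -- coefficients have to be bounded locally.
  have hS : {z | z ∈ offAxis d ∧ ∀ i, ‖rayCoeff i z‖ < ‖rayCoeff i y‖ + 1} ∈ 𝓝 y := by
    refine Eventually.and (isOpen_offAxis.eventually_mem hy) (eventually_all.2 fun i => ?_)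
    have := ((isMultiplier_rayCoeff i).smooth.contDiffAt
      (isOpen_offAxis.mem_nhds hy)).continuousAt.norm
    exact this.eventually_lt continuousAt_const (lt_add_one _)
  have hbound : Integrable fun σ : ℝ => ∑ i, C i * (1 + σ ^ 2)⁻¹ * (‖rayCoeff i y‖ + 1) :=
    integrable_finsetSum _ fun i _ => (integrable_inv_one_add_sq.const_mul (C i)).mul_const _
  have hmeas : AEStronglyMeasurable
      fun σ => ∑ i, rayIntegrand (rayOperator i Φ) y σ • rayCoeff i y :=
    (continuous_finsetSum _ fun i _ =>
      (continuous_rayIntegrand _ y).smul continuous_const).aestronglyMeasurable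
  have hle (σ : ℝ) (z : Euc d × ℝ)
      (hz : z ∈ {z | z ∈ offAxis d ∧ ∀ i, ‖rayCoeff i z‖ < ‖rayCoeff i y‖ + 1}) :
      ‖∑ i, rayIntegrand (rayOperator i Φ) z σ • rayCoeff i z‖ ≤
        ∑ i, C i * (1 + σ ^ 2)⁻¹ * (‖rayCoeff i y‖ + 1) := by
    refine (norm_sum_le _ _).trans (Finset.sum_le_sum fun i _ => ?_)
    rw [norm_smul, norm_rayIntegrand]
    exact mul_le_mul (h i _ (norm_direction hz.1) σ) (hz.2 i).le (norm_nonneg _)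
      (mul_nonneg (hC i) (by positivity))
  have key := hasFDerivAt_integral_of_dominated_of_fderiv_le hS
    (.of_forall fun z => (continuous_rayIntegrand Φ z).aestronglyMeasurable)
    (integrable_rayIntegrand Φ hy) hmeas (.of_forall hle) hbound
    (.of_forall fun σ z hz => hasFDerivAt_rayIntegrand Φ hz.1 σ)
  refine key.congr_fderiv ?_
  rw [integral_finsetSum _ hint]
  exact Finset.sum_congr rfl fun i _ => integral_smul_const _ _

/-- The inverse Fourier transform of `Φ` along the lines through the origin. -/
def rayTransform (d : ℕ) : 𝓢(Euc d, ℂ) →ₗ[ℂ] (Sph d × ℝ → ℂ) where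
  toFun Φ q := ∫ σ, rayIntegrand Φ ((q.1 : Euc d), q.2) σ
  map_add' Φ Ψ := by
    funext q
    have h := sph_mem_offAxis q.1 q.2
    refine Eq.trans ?_ (integral_add (integrable_rayIntegrand Φ h) (integrable_rayIntegrand Ψ h))
    exact integral_congr_ae (.of_forall fun σ => by simp [rayIntegrand, mul_add])
  map_smul' c Φ := by
    funext q
    refine Eq.trans ?_ (integral_const_mul c _)
    exact integral_congr_ae (.of_forall fun σ => by simp [rayIntegrand, mul_left_comm])

/-- The integrand sees `y.1` only through its direction, so the integral is already homogeneous of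
degree 0. -/
lemma homExt_rayTransform (Φ : 𝓢(Euc d, ℂ)) {y : Euc d × ℝ} (hy : y ∈ offAxis d) :
    homExt (rayTransform d Φ) y = ∫ σ, rayIntegrand Φ y σ := by
  obtain ⟨x, p⟩ := y
  rw [homExt_of_ne _ hy]
  have h : ((radialProj x hy : Sph d) : Euc d) = direction x := rfl
  have h2 : direction (direction x) = direction x := by
    rw [direction, norm_direction hy, inv_one, one_smul]
  simp [rayTransform, rayIntegrand, h, h2]

lemma hasFDerivAt_homExt_rayTransform (Φ : 𝓢(Euc d, ℂ)) {y : Euc d × ℝ} (hy : y ∈ offAxis d) :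
    HasFDerivAt (homExt (rayTransform d Φ))
      (∑ i, homExt (rayTransform d (rayOperator i Φ)) y • rayCoeff i y) y := by
  simp only [homExt_rayTransform _ hy]
  exact (hasFDerivAt_integral_rayIntegrand Φ hy).congr_of_eventuallyEq
    (eventuallyEq_of_mem (isOpen_offAxis.mem_nhds hy) fun z hz => homExt_rayTransform Φ hz)

open FourierTransform in
lemma rayTransform_fourier (φ : 𝓢(Euc d, ℂ)) (q : Sph d × ℝ) :
    rayTransform d (𝓕 φ) q = ∫ y, φ (slice q.1 q.2 y) := by
  rw [integral_slice_eq]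
  simp [rayTransform, rayIntegrand, direction]

open FourierTransform in
-- Decay in p is read off on the other side of the slice theorem: the transform of `Φ` is the
-- hyperplane integral of the inverse Fourier transform of `Φ`, which depends continuously on `Φ`.
lemma boundedBySeminorm_rayTransform (k : ℕ) : BoundedBySeminorm
    fun (Φ : 𝓢(Euc d, ℂ)) (q : Sph d × ℝ) => (1 + |q.2|) ^ k * ‖rayTransform d Φ q‖ := by
  obtain ⟨r, hr, h⟩ := boundedBySeminorm_schwartz (E := Euc d) (k + (d + 1)) 0
  let c : NNReal := ⟨∫ y : EuclideanSpace ℝ (Fin d), ((1 + ‖y‖) ^ (d + 1))⁻¹,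
    integral_nonneg fun y => by positivity⟩
  refine ⟨c • r.comp (fourierInvCLM ℂ 𝓢(Euc d, ℂ) : 𝓢(Euc d, ℂ) →ₗ[ℂ] 𝓢(Euc d, ℂ)), ?_,
    fun Φ q => ?_⟩
  · exact (hr.comp (fourierInvCLM ℂ 𝓢(Euc d, ℂ)).continuous).const_smul c
  · have h1 : ∀ x, (1 + ‖x‖) ^ (k + (d + 1)) * ‖(𝓕⁻ Φ) x‖ ≤ r (𝓕⁻ Φ) := fun x => by
      simpa only [norm_iteratedFDeriv_zero] using h (𝓕⁻ Φ) x
    have h2 := norm_integral_slice_le h1 q.1 q.2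
    rw [← rayTransform_fourier, fourier_fourierInv_eq] at h2
    exact h2

/-- `rayTransform` as a continuous linear map. -/
def rayTransformCLM (d : ℕ) : 𝓢(Euc d, ℂ) →L[ℂ] SphereSchwartz d :=
  SphereSchwartz.mkCLMOfDeriv (rayTransform d) rayOperator isMultiplier_rayCoeff
    (fun Φ _ hy => hasFDerivAt_homExt_rayTransform Φ hy) boundedBySeminorm_rayTransform

/-- The Radon transform of Schwartz functions. -/
def radonSchwartzCLM (d : ℕ) : 𝓢(Euc d, ℂ) →L[ℂ] SphereSchwartz d :=
  rayTransformCLM d ∘L FourierTransform.fourierCLM ℂ 𝓢(Euc d, ℂ)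

lemma radonSchwartzCLM_apply (φ : 𝓢(Euc d, ℂ)) (q : Sph d × ℝ) :
    radonSchwartzCLM d φ q = radon φ q := by
  rw [radon_eq_integral_slice]
  exact rayTransform_fourier φ q

/-! ### Vanishing moments of the Radon transform -/

lemma lizorkin.integral_inner_pow_mul (φ : lizorkin d) (w : Euc d) (k : ℕ) :
    Integrable (fun x : Euc d => (⟪x, w⟫_ℝ : ℂ) ^ k * (φ : 𝓢(Euc d, ℂ)) x) ∧
      ∫ x : Euc d, (⟪x, w⟫_ℝ : ℂ) ^ k * (φ : 𝓢(Euc d, ℂ)) x = 0 := by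
  -- The multinomial formula turns a power of a linear form into monomials, whose moments vanish.
  have h (x : Euc d) : (⟪x, w⟫_ℝ : ℂ) ^ k * (φ : 𝓢(Euc d, ℂ)) x =
      ∑ m ∈ Finset.piAntidiag Finset.univ k, (Nat.multinomial Finset.univ m * ∏ i, w i ^ m i : ℂ) *
        (((∏ i, x i ^ m i : ℝ) : ℂ) * (φ : 𝓢(Euc d, ℂ)) x) := by
    have h1 : (⟪x, w⟫_ℝ : ℂ) = ∑ i, (w i : ℂ) * (x i : ℂ) := by
      simp [PiLp.inner_apply]
    rw [h1, Finset.sum_pow_eq_sum_piAntidiag, Finset.sum_mul]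
    refine Finset.sum_congr rfl fun m _ => ?_
    push_cast
    simp only [mul_pow, Finset.prod_mul_distrib]
    ring
  have hint (m : Fin (d + 1) → ℕ) := (integrable_moment m (φ : 𝓢(Euc d, ℂ))).const_mul
    (Nat.multinomial Finset.univ m * ∏ i, w i ^ m i : ℂ)
  simp only [h]
  refine ⟨integrable_finsetSum _ fun m _ => hint m, ?_⟩
  rw [integral_finsetSum _ fun m _ => hint m]
  refine Finset.sum_eq_zero fun m _ => ?_
  rw [integral_const_mul, φ.2 m, mul_zero]

/-- On the hyperplane p equals x·u, so by Fubini the k-th moment of Rφ(u, ·) is the integral of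
(x·u)^k φ(x). -/
lemma radonSchwartzCLM_mem (φ : lizorkin d) : radonSchwartzCLM d φ ∈ sphereLizorkin d := by
  intro u k
  have h := lizorkin.integral_inner_pow_mul φ (u : Euc d) k
  refine Eq.trans ?_ h.2
  rw [← integral_integral_slice h.1 u]
  refine integral_congr_ae (.of_forall fun p => ?_)
  simp only [radonSchwartzCLM_apply, radon_eq_integral_slice, inner_slice]
  exact (integral_const_mul _ _).symm

/-- The Radon transform as a continuous linear map between the Lizorkin spaces. -/
def radonCLM (d : ℕ) : lizorkin d →L[ℂ] sphereLizorkin d :=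
  (radonSchwartzCLM d ∘L (lizorkin d).subtypeL).codRestrict (sphereLizorkin d) radonSchwartzCLM_mem

lemma coe_radonCLM (φ : lizorkin d) :
    (radonCLM d φ : SphereSchwartz d) = radonSchwartzCLM d (φ : 𝓢(Euc d, ℂ)) := rfl

lemma radonCLM_apply (φ : lizorkin d) (q : Sph d × ℝ) :
    (radonCLM d φ : SphereSchwartz d) q = radon (φ : 𝓢(Euc d, ℂ)) q :=
  (congrFun (congrArg Subtype.val (coe_radonCLM φ)) q).trans (radonSchwartzCLM_apply φ q)

end RadonLizorkin

end

theorem corollary6p1 (d : ℕ) (hd : 1 ≤ d) :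
    (∃ R : RadonLizorkin.lizorkin d →L[ℂ] RadonLizorkin.sphereLizorkin d,
      ∀ (φ : RadonLizorkin.lizorkin d) (q : RadonLizorkin.Sph d × ℝ),
        (R φ : RadonLizorkin.SphereSchwartz d) q =
          RadonLizorkin.radon (φ : SchwartzMap (RadonLizorkin.Euc d) ℂ) q) ∧
    (∃ Rdual : RadonLizorkin.sphereLizorkin d →L[ℂ] RadonLizorkin.lizorkin d,
      ∀ (ρ : RadonLizorkin.sphereLizorkin d) (x : RadonLizorkin.Euc d),
        (Rdual ρ : SchwartzMap (RadonLizorkin.Euc d) ℂ) x =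
          RadonLizorkin.dualRadon (ρ : RadonLizorkin.SphereSchwartz d) x) := by
  exact ⟨⟨RadonLizorkin.radonCLM d, RadonLizorkin.radonCLM_apply⟩,
    ⟨RadonLizorkin.SphereLizorkin.dualRadonCLM d,
      RadonLizorkin.SphereLizorkin.dualRadonCLM_apply⟩⟩
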